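/- **Setting.** Let $\mathcal T$ be a commutative semiring with zero $0$, unit $1$, addition $\oplus$, and a *symmetry*, i.e. an additive map $a\mapsto\ominus a$ with $\ominus 0=0$, $\ominus(ab)=a(\ominus b)=(\ominus a)b$ and $\ominus(\ominus a)=a$. Write $a\ominus b=a\oplus(\ominus b)$, $a^\circ=a\ominus a$, $\mathcal T^\circ=\{a^\circ: a\in\mathcal T\}$, let $\mathcal T^*$ be the set of invertible elements, $\mathcal T^\vee=\mathcal T^*\cup\{0\}$, and on any commutative semiring let $a\preceq b$ mean $b=a\oplus c$ for some $c$. Assume that $\preceq$ is antisymmetric on $\mathcal T$, and that $\mathcal T$ has a *modulus* $a\mapsto|a|$, a surjective semiring morphism onto a totally ordered idempotent semifield $\mathcal M$ (idempotent addition, $0\neq1$, every nonzero element invertible, $\preceq$ total), such that for all $a,b\in\mathcal T$: * if $|a|\preceq|b|$ and $|a|\ne|b|$, then $a\oplus b=b$; * if $a\preceq b$, $|a|=|b|$ and $b\in\mathcal T^\vee$, then $a=b$; * $a^\circ\oplus a^\circ=a^\circ$. For $A\in\mathcal T^{n\times n}$, $n\ge0$, let $\det A=\bigoplus_{\sigma}\operatorname{sign}(\sigma)\prod_i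 a_{i,\sigma(i)}$, where $\operatorname{sign}(\sigma)$ is $\ominus 1$ to the power of the number of inversions of $\sigma$; $A$ is *nonsingular* if $\det A\in\mathcal T^*$. In that case $A^\nabla=\det(A)^{-1}\operatorname{adj}(A)$, where $\operatorname{adj}(A)_{i,j}=(\ominus 1)^{i+j}\det(A_{(j,i)})$ and $A_{(j,i)}$ is $A$ without row $j$ and column $i$. Let $f_A=\det(X\mathcal I\ominus A)\in\mathcal T[X]$ (the symmetry acts on polynomials coefficientwise). A *root* of $f=\bigoplus_k a_kX^k\in\mathcal T[X]$ is an $r\in\mathcal T^\vee$ with $f(r)\in\mathcal T^\circ$. A root $r$ is a *corner root* if either $r=0$ and $f(0)=0$, or $r\in\mathcal T^*$ and there is a set $S$ of at least two indices $k$, each with $a_k\in\mathcal T^*$ and $|a_kr^k|=|f(r)|$, such that $f(r)=\bigoplus_{k\in S}a_kr^k$. The *eigenvalues* of $A$ are the corner roots of $f_A$. The *supertropical semiring* is $\mathbb R\cup\mathbb R^\nu\cup\{-\infty\}$, where $\mathbb R^\nu=\{a^\nu:a\in\mathbb R\}$ is a second (ghost) copy of $\mathbb R$ and we set $(a^\nu)^\nu=a^\nu$,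 $(-\infty)^\nu=-\infty$. Its zero is $-\infty$ and its unit is the real number $0$; the sum of two elements is the one with the larger underlying value in $\mathbb R\cup\{-\infty\}$, and is $a^\nu$ if both have the same underlying value as $a$. The product adds underlying values, is $-\infty$ if a factor is, and otherwise is a ghost exactly when some factor is a ghost. Its symmetry is the identity, and its modulus sends an element to its underlying value in $\mathbb R_{\max}=(\mathbb R\cup\{-\infty\},\max,+)$. **Statement.** Assume $\mathcal T\neq\mathcal T^\circ$, let $A,M\in\mathcal T^{n\times n}$, and assume one of the following: 1. $M=E^\nabla AE$ for a nonsingular $E\in\mathcal T^{n\times n}$, and $g:\mathcal T\to\mathcal T$ is the identity; 2. $A$ is nonsingular, $M=A^\nabla$, and $g:\mathcal T^*\to\mathcal T^*$, $g(x)=x^{-1}$; 3. $\mathcal T$ is the supertropical semiring, $M=A^m$ for an integer $m\ge1$, and $g:\mathcal T\to\mathcal T$, $g(x)=x^m$. Then $g$ is a bijection, and: * if $\gamma$ is a root of $f_A$, then $g(\gamma)$ is a root of $f_M$; * if $\lambda$ is an eigenvalue of $M$, then $g^{-1}(\lambda)$ is an eigenvalue of $A$. In case 2 this includes that every root $\gamma$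 of $f_A$ and every eigenvalue $\lambda$ of $M$ lies in $\mathcal T^*$, so that $g(\gamma)$ and $g^{-1}(\lambda)$ are defined. -/

import Mathlib

namespace ExtTrop

open Polynomial

/-! ### Semirings with a symmetry -/

/-- A symmetry of the commutative semiring `S`: an involutive additive map `a ↦ ⊖ a` with
`⊖ (a b) = a (⊖ b) = (⊖ a) b`. The identity is allowed. -/
class Symmetry (S : Type*) [CommSemiring S] where
  sym : S → S
  sym_add : ∀ a b, sym (a + b) = sym a + sym b
  sym_zero : sym 0 = 0
  sym_mul_right : ∀ a b, sym (a * b) = a * sym b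
  sym_mul_left : ∀ a b, sym (a * b) = sym a * b
  sym_sym : ∀ a, sym (sym a) = a

/-- `a ≼ b` if and only if `b = a ⊕ c` for some `c`. -/
def NatLE {S : Type*} [CommSemiring S] (a b : S) : Prop := ∃ c, b = a + c

/-- `a° = a ⊖ a`. -/
def bal {S : Type*} [CommSemiring S] [Symmetry S] (a : S) : S := a + Symmetry.sym a

/-- `S° = {a° : a ∈ S}`. -/
def balSet (S : Type*) [CommSemiring S] [Symmetry S] : Set S := Set.range bal

/-- `S^∨ = S^* ∪ {0}`, where `S^*` is the set of invertible elements. -/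
def thinSet (S : Type*) [CommSemiring S] : Set S := {a | IsUnit a ∨ a = 0}

/-- `M` is a totally ordered idempotent (commutative) semifield: its addition is idempotent,
nonzero elements are invertible, and its natural order is total. -/
structure IsTotalIdemSemifield (M : Type*) [CommSemiring M] : Prop where
  isField : IsField M
  add_idem : ∀ a : M, a + a = a
  total : ∀ a b : M, NatLE a b ∨ NatLE b a

/-- The standing assumptions on `T`: a commutative semiring with symmetry that is naturally
ordered, has a modulus `μ = |·|` (a surjective semiring morphism) onto a totally ordered
idempotent semifield `M`, and satisfies the three properties in the last three fields. -/
structure IsExtendedTropical {T M : Type*} [CommSemiring T] [Symmetry T] [CommSemiring M]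
    (μ : T →+* M) : Prop where
  semifield : IsTotalIdemSemifield M
  modulus_surjective : Function.Surjective μ
  /-- the natural preorder of `T` is an order -/
  natLE_antisymm : ∀ a b : T, NatLE a b → NatLE b a → a = b
  /-- if `|a| ≺ |b|` then `a ⊕ b = b` -/
  add_eq_of_lt : ∀ a b : T, NatLE (μ a) (μ b) → μ a ≠ μ b → a + b = b
  /-- if `a ≼ b`, `|a| = |b|` and `b ∈ T^∨` then `a = b` -/
  eq_of_natLE : ∀ a b : T, NatLE a b → μ a = μ b → b ∈ thinSet T → a = b
  /-- `a° ⊕ a° = a°` -/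
  bal_add_bal : ∀ a : T, bal a + bal a = bal a

/-! ### Matrices -/

/-- The sign of a permutation in `S`: `(⊖ 1)` to the number of inversions, that is `1` for even
and `⊖ 1` for odd permutations. -/
def sgn (S : Type*) [CommSemiring S] [Symmetry S] {n : ℕ} (σ : Equiv.Perm (Fin n)) : S :=
  if Equiv.Perm.sign σ = 1 then 1 else Symmetry.sym 1

/-- The determinant `⊕_σ sign(σ) ⊙_i a_{i,σ(i)}`. -/
def det {S : Type*} [CommSemiring S] [Symmetry S] {n : ℕ} (A : Matrix (Fin n) (Fin n) S) : S :=
  ∑ σ : Equiv.Perm (Fin n), sgn S σ * ∏ i, A i (σ i)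

/-- `A` is nonsingular if `det A` is invertible in the semiring. -/
def Nonsingular {S : Type*} [CommSemiring S] [Symmetry S] {n : ℕ}
    (A : Matrix (Fin n) (Fin n) S) : Prop := IsUnit (det A)

/-- The adjoint matrix: `adj(A)_{i,j} = (⊖ 1)^{i+j} det(A_{(j,i)})`, where `A_{(j,i)}` is `A` with
row `j` and column `i` deleted. -/
def adj {S : Type*} [CommSemiring S] [Symmetry S] :
    {n : ℕ} → Matrix (Fin n) (Fin n) S → Matrix (Fin n) (Fin n) S
  | 0, A => A
  | _ + 1, A => Matrix.of fun i j =>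
      (Symmetry.sym (1 : S)) ^ ((i : ℕ) + (j : ℕ)) * det (A.submatrix j.succAbove i.succAbove)

/-- The quasi-inverse `A^∇ = adj(A) det(A)⁻¹`, meaningful for nonsingular `A`
(`Ring.inverse` is the inverse on invertible elements). -/
noncomputable def quasiInv {S : Type*} [CommSemiring S] [Symmetry S] {n : ℕ}
    (A : Matrix (Fin n) (Fin n) S) : Matrix (Fin n) (Fin n) S :=
  Ring.inverse (det A) • adj A

/-! ### Polynomials -/

/-- The symmetry of `S[X]` induced by that of `S`; see `coeff_sym`: it acts on coefficients. -/
noncomputable instance polySymmetry (S : Type*) [CommSemiring S] [Symmetry S] :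
    Symmetry S[X] where
  sym p := C (Symmetry.sym 1) * p
  sym_add p q := mul_add _ p q
  sym_zero := mul_zero _
  sym_mul_right p q := mul_left_comm _ p q
  sym_mul_left p q := (mul_assoc _ p q).symm
  sym_sym p := by
    rw [← mul_assoc, ← C_mul, ← Symmetry.sym_mul_left, one_mul, Symmetry.sym_sym, C_1, one_mul]

theorem coeff_sym {S : Type*} [CommSemiring S] [Symmetry S] (p : S[X]) (k : ℕ) :
    (Symmetry.sym p).coeff k = Symmetry.sym (p.coeff k) := by
  change (C (Symmetry.sym 1) * p).coeff k = _
  rw [coeff_C_mul, ← Symmetry.sym_mul_left, one_mul]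

/-- The formal characteristic polynomial `f_A = det(X I ⊖ A)`. -/
noncomputable def charpoly {S : Type*} [CommSemiring S] [Symmetry S] {n : ℕ}
    (A : Matrix (Fin n) (Fin n) S) : S[X] :=
  det (Matrix.of fun i j =>
    (if i = j then (X : S[X]) else 0) + Symmetry.sym (C (A i j)))

/-- `r ∈ S^∨` is a root of `f` if `f(r) ∈ S°`. -/
def IsRoot {S : Type*} [CommSemiring S] [Symmetry S] (f : S[X]) (r : S) : Prop :=
  r ∈ thinSet S ∧ f.eval r ∈ balSet S

/-- A root `r` of `f = ⊕ a_k X^k` is a corner root if either `r` is invertible and `f(r)` is the sum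
of at least two essential monomials at `r` with invertible coefficients (monomials `a_k X^k`
with `|a_k r^k| = |f(r)|` and `a_k` invertible), or `r = 0` and `f(r) = 0`. -/
def IsCornerRoot {T M : Type*} [CommSemiring T] [Symmetry T] [CommSemiring M] (μ : T →+* M)
    (f : T[X]) (r : T) : Prop :=
  IsRoot f r ∧
    ((IsUnit r ∧ ∃ K : Finset ℕ,
        (∀ k ∈ K, k ≤ f.natDegree ∧ μ (f.coeff k * r ^ k) = μ (f.eval r) ∧ IsUnit (f.coeff k)) ∧
        2 ≤ K.card ∧ f.eval r = ∑ k ∈ K, f.coeff k * r ^ k) ∨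
      (r = 0 ∧ f.eval r = 0))

/-- The eigenvalues of `A` are the corner roots of its characteristic polynomial. -/
def IsEigenvalue {T M : Type*} [CommSemiring T] [Symmetry T] [CommSemiring M] (μ : T →+* M)
    {n : ℕ} (A : Matrix (Fin n) (Fin n) T) (r : T) : Prop :=
  IsCornerRoot μ (charpoly A) r

/-! ### The supertropical semiring -/

/-- The max-plus semiring `ℝ ∪ {-∞}`: addition is `max`, multiplication is `+`. Mathlib's `Tropical`
uses `min` and `+∞`, hence the order dual; the added top element plays the role of `-∞`. -/
abbrev RMax : Type := Tropical (WithTop ℝᵒᵈ)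

/-- The inclusion of `ℝ` in `RMax`. -/
def RMax.ofReal (a : ℝ) : RMax := Tropical.trop ((OrderDual.toDual a : ℝᵒᵈ) : WithTop ℝᵒᵈ)

theorem RMax.ofReal_add (a b : ℝ) :
    RMax.ofReal a + RMax.ofReal b = RMax.ofReal (max a b) := by
  rw [RMax.ofReal, RMax.ofReal, RMax.ofReal, ← Tropical.trop_inf, ← WithTop.coe_min]
  rfl

theorem RMax.ofReal_mul (a b : ℝ) : RMax.ofReal a * RMax.ofReal b = RMax.ofReal (a + b) := rfl

/-- The supertropical semiring `ℝ ∪ ℝ^ν ∪ {-∞}`. -/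
inductive Supertropical : Type
  /-- the element `-∞` -/
  | bot : Supertropical
  /-- the copy `ℝ` -/
  | tan (a : ℝ) : Supertropical
  /-- the ghost copy `ℝ^ν` -/
  | gho (a : ℝ) : Supertropical

namespace Supertropical

/-- The underlying element of `ℝ ∪ {-∞}`. -/
def val : Supertropical → WithBot ℝ
  | bot => ⊥
  | tan a => (a : WithBot ℝ)
  | gho a => (a : WithBot ℝ)

/-- The map `a ↦ a^ν`. -/
def nu : Supertropical → Supertropical
  | bot => bot
  | tan a => gho a
  | gho a => gho a

open Classical in
/-- `a ⊕ b` is the one with larger `ν`-value, and `a^ν` if the `ν`-values agree. -/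
noncomputable def add (a b : Supertropical) : Supertropical :=
  if b.val < a.val then a else if a.val < b.val then b else a.nu

/-- Multiplication adds the values; a product with a ghost factor is a ghost. -/
def mul : Supertropical → Supertropical → Supertropical
  | bot, _ => bot
  | _, bot => bot
  | tan a, tan b => tan (a + b)
  | tan a, gho b => gho (a + b)
  | gho a, tan b => gho (a + b)
  | gho a, gho b => gho (a + b)

noncomputable instance : Add Supertropical := ⟨add⟩
noncomputable instance : Mul Supertropical := ⟨mul⟩
instance : Zero Supertropical := ⟨bot⟩
instance : One Supertropical := ⟨tan 0⟩

theorem add_def (a b : Supertropical) : a + b = add a b := rfl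
theorem mul_def (a b : Supertropical) : a * b = mul a b := rfl
theorem zero_def : (0 : Supertropical) = bot := rfl
theorem one_def : (1 : Supertropical) = tan 0 := rfl

theorem bot_add (a : Supertropical) : bot + a = a := by
  cases a <;> simp [add_def, add, val, nu]
theorem add_bot (a : Supertropical) : a + bot = a := by
  cases a <;> simp [add_def, add, val, nu]
theorem tan_add_tan (a b : ℝ) :
    tan a + tan b = if b < a then tan a else if a < b then tan b else gho a := by
  simp [add_def, add, val, nu]
theorem tan_add_gho (a b : ℝ) : tan a + gho b = if b < a then tan a else gho b := by
  simp only [add_def, add, val, nu, WithBot.coe_lt_coe]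
  grind
theorem gho_add_tan (a b : ℝ) : gho a + tan b = if a < b then tan b else gho a := by
  simp only [add_def, add, val, nu, WithBot.coe_lt_coe]
  grind
theorem gho_add_gho (a b : ℝ) : gho a + gho b = if a < b then gho b else gho a := by
  simp only [add_def, add, val, nu, WithBot.coe_lt_coe]
  grind
theorem bot_mul (a : Supertropical) : bot * a = bot := by cases a <;> rfl
theorem mul_bot (a : Supertropical) : a * bot = bot := by cases a <;> rfl
theorem tan_mul_tan (a b : ℝ) : tan a * tan b = tan (a + b) := rfl
theorem tan_mul_gho (a b : ℝ) : tan a * gho b = gho (a + b) := rfl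
theorem gho_mul_tan (a b : ℝ) : gho a * tan b = gho (a + b) := rfl
theorem gho_mul_gho (a b : ℝ) : gho a * gho b = gho (a + b) := rfl

theorem add_comm' (a b : Supertropical) : a + b = b + a := by
  cases a <;> cases b <;>
    grind [bot_add, add_bot, tan_add_tan, tan_add_gho, gho_add_tan, gho_add_gho]

theorem add_assoc' (a b c : Supertropical) : a + b + c = a + (b + c) := by
  cases a <;> cases b <;> cases c <;>
    grind [bot_add, add_bot, tan_add_tan, tan_add_gho, gho_add_tan, gho_add_gho]

theorem mul_comm' (a b : Supertropical) : a * b = b * a := by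
  cases a <;> cases b <;> simp [mul_def, mul, add_comm]

theorem mul_add' (a b c : Supertropical) : a * (b + c) = a * b + a * c := by
  cases a <;> cases b <;> cases c <;>
    simp only [bot_add, add_bot, tan_add_tan, tan_add_gho, gho_add_tan, gho_add_gho, bot_mul,
      mul_bot, mul_ite, tan_mul_tan, tan_mul_gho, gho_mul_tan, gho_mul_gho,
      add_lt_add_iff_left] <;>
    grind

noncomputable instance : CommSemiring Supertropical where
  add_assoc := add_assoc'
  zero_add := bot_add
  add_zero := add_bot
  add_comm := add_comm'
  left_distrib := mul_add'
  right_distrib a b c := by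
    rw [mul_comm', mul_add', mul_comm' c a, mul_comm' c b]
  zero_mul := bot_mul
  mul_zero := mul_bot
  mul_assoc a b c := by
    cases a <;> cases b <;> cases c <;> simp [mul_def, mul, add_assoc]
  one_mul a := by cases a <;> simp [mul_def, one_def, mul]
  mul_one a := by cases a <;> simp [mul_def, one_def, mul]
  mul_comm := mul_comm'
  nsmul := nsmulRec

/-- The symmetry of the supertropical semiring is the identity. -/
noncomputable instance : Symmetry Supertropical where
  sym a := a
  sym_add _ _ := rfl
  sym_zero := rfl
  sym_mul_right _ _ := rfl
  sym_mul_left _ _ := rfl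
  sym_sym _ := rfl

/-- The underlying element of the max-plus semiring. -/
def toRMax : Supertropical → RMax
  | bot => 0
  | tan a => RMax.ofReal a
  | gho a => RMax.ofReal a

/-- The modulus `|·|` of the supertropical semiring, with values in the max-plus semiring. -/
noncomputable def modulus : Supertropical →+* RMax where
  toFun := toRMax
  map_zero' := rfl
  map_one' := rfl
  map_add' a b := by
    cases a <;> cases b <;>
      simp only [bot_add, add_bot, tan_add_tan, tan_add_gho, gho_add_tan, gho_add_gho, toRMax,
        zero_add, add_zero, RMax.ofReal_add] <;>
      grind [toRMax]
  map_mul' a b := by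
    cases a <;> cases b <;> simp [mul_def, mul, toRMax, RMax.ofReal_mul]

end Supertropical

end ExtTrop

/-!
The heart of the matter is a relation between characteristic polynomials. Write `a ≽° b` when `a` is
the sum of `b` and of a balanced element `r ⊖ r`. Then, coefficientwise,
`f_{E^∇AE} ≽° f_A` and `det(A) f_{A^∇} ≽° det(X A ⊖ I)` over every commutative semiring with
symmetry, and over the supertropical semiring `f_{A^m} ≽° f_A^{(m)}`, where `f_A^{(m)}` has as
coefficients the `m`-th powers of those of `f_A`.

Such a relation settles both claims. Balanced elements are closed under addition, so a root of the
smaller polynomial is a root of the larger one (`IsRoot.of_surpasses`). Conversely, in an extended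
tropical semiring with `T ≠ T°` an invertible element surpasses only itself
(`IsExtendedTropical.eq_of_surpasses`), so the invertible coefficients exhibiting a corner root of
the larger polynomial are coefficients of the smaller one too, and antisymmetry of the natural
order gives both polynomials the same value there
(`IsExtendedTropical.isCornerRoot_of_surpasses`). What remains is to replace `γ` by `γ⁻¹` in the
reversed polynomial, respectively by `γ^m` along the automorphism `x ↦ x^m` of the supertropical
semiring.

The relations come from the strong transfer principle (`FreeSym.surpasses_of_toInt_eq`): formal
expressions `p`, `q` that agree over commutative rings satisfy `p ≽° q` in every commutative
semiring with symmetry if no monomial of `q` occurs with both signs. The powers of `det(E)` that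
appear do not satisfy this condition, so they are produced one at a time: the relation
`det(A) det(det(A) U ⊖ V adj(A) H) ≽° det(A)^k det (A H; V U)` for the Schur complement
(`surpasses_schur`) is proved by induction on the size of `U`. Each step is a Laplace expansion and
one transfer with right-hand side `det(A) det (A H; V U)`. That this product is reduced is a fact
about signs of permutations (`sign_mul_sign_eq_of_pairs`). A last transfer, with right-hand side
`det(E) det(Y I ⊕ W A)`, in which each monomial occurs once (`FreeSym.isSimple_genericChar`), turns
the block determinants into characteristic polynomials.

For powers it is enough to treat a prime exponent `p`. In characteristic `p` one has
`det(Y^p I + A^p) = det(Y I + A)^p`, so the coefficients of `det(Y^p I + A^p)` agree modulo `p` with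
those of `det(Y I + A)` at the `p`-th powers of the variables. In the supertropical semiring all
natural numbers from `2` on are the same ghost, and this congruence already gives the relation
(`Supertropical.surpasses_lift`).
-/

namespace ExtTrop

open Polynomial

/-! ### Determinants over semirings with a symmetry -/

/-- The sign of a permutation with `⊖ 1` replaced by an arbitrary element `e`. -/
def signOf {S : Type*} [CommSemiring S] (e : S) {ι : Type*} [Fintype ι] [DecidableEq ι]
    (σ : Equiv.Perm ι) : S :=
  if Equiv.Perm.sign σ = 1 then 1 else e

/-- The determinant over a commutative semiring in which `e` plays the role of `⊖ 1`, for matrices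
indexed by any finite type. -/
def signedDet {S : Type*} [CommSemiring S] (e : S) {ι : Type*} [Fintype ι] [DecidableEq ι]
    (A : Matrix ι ι S) : S :=
  ∑ σ : Equiv.Perm ι, signOf e σ * ∏ i, A i (σ i)

/-- The adjoint matrix over a commutative semiring in which `e` plays the role of `⊖ 1`. -/
def signedAdj {S : Type*} [CommSemiring S] (e : S) :
    {n : ℕ} → Matrix (Fin n) (Fin n) S → Matrix (Fin n) (Fin n) S
  | 0, A => A
  | _ + 1, A => Matrix.of fun i j =>
      e ^ ((i : ℕ) + (j : ℕ)) * signedDet e (A.submatrix j.succAbove i.succAbove)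

section signedDet

variable {S S' : Type*} [CommSemiring S] [CommSemiring S'] {ι : Type*} [Fintype ι] [DecidableEq ι]

theorem signOf_one (e : S) : signOf e (1 : Equiv.Perm ι) = 1 := by simp [signOf]

theorem signOf_inv (e : S) (σ : Equiv.Perm ι) : signOf e σ⁻¹ = signOf e σ := by
  simp [signOf]

theorem signOf_mul {e : S} (he : e * e = 1) (σ τ : Equiv.Perm ι) :
    signOf e (σ * τ) = signOf e σ * signOf e τ := by
  unfold signOf
  rcases Int.units_eq_one_or (Equiv.Perm.sign σ) with h | h <;>
    rcases Int.units_eq_one_or (Equiv.Perm.sign τ) with h' | h' <;> simp [h, h', he]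

theorem map_signOf (f : S →+* S') (e : S) (σ : Equiv.Perm ι) :
    f (signOf e σ) = signOf (f e) σ := by
  unfold signOf; split_ifs <;> simp

theorem signOf_neg_one {R : Type*} [CommRing R] (σ : Equiv.Perm ι) :
    signOf (-1 : R) σ = ((Equiv.Perm.sign σ : ℤ) : R) := by
  unfold signOf
  rcases Int.units_eq_one_or (Equiv.Perm.sign σ) with h | h <;> simp [h]

theorem map_signedDet (f : S →+* S') (e : S) (A : Matrix ι ι S) :
    f (signedDet e A) = signedDet (f e) (A.map f) := by
  simp [signedDet, map_sum, map_prod, map_signOf]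

theorem map_signedAdj (f : S →+* S') (e : S) {n : ℕ} (A : Matrix (Fin n) (Fin n) S) :
    (signedAdj e A).map f = signedAdj (f e) (A.map f) := by
  cases n with
  | zero => rfl
  | succ n =>
    ext i j
    simp [signedAdj, map_signedDet, Matrix.submatrix_map]

theorem signedDet_transpose (e : S) (A : Matrix ι ι S) :
    signedDet e A.transpose = signedDet e A := by
  unfold signedDet
  refine Fintype.sum_equiv (Equiv.inv _) _ _ fun σ => ?_
  rw [Equiv.inv_apply, signOf_inv]
  congr 1
  rw [← Equiv.prod_comp σ⁻¹]
  simp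

theorem signedDet_neg_one {R : Type*} [CommRing R] (A : Matrix ι ι R) :
    signedDet (-1) A = A.det := by
  rw [← signedDet_transpose, Matrix.det_apply', signedDet]
  simp [signOf_neg_one]

theorem signedAdj_neg_one {R : Type*} [CommRing R] {n : ℕ} (A : Matrix (Fin n) (Fin n) R) :
    signedAdj (-1) A = A.adjugate := by
  cases n with
  | zero => exact Subsingleton.elim _ _
  | succ n =>
    ext i j
    rw [Matrix.adjugate_fin_succ_eq_det_submatrix, signedAdj, Matrix.of_apply, signedDet_neg_one,
      add_comm]

theorem signedDet_one (e : S) : signedDet e (1 : Matrix ι ι S) = 1 := by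
  unfold signedDet
  rw [Finset.sum_eq_single 1]
  · rw [signOf_one, one_mul]
    exact Finset.prod_eq_one fun i _ => Matrix.one_apply_eq i
  · intro σ _ hσ
    obtain ⟨i, hi⟩ : ∃ i, σ i ≠ i := by
      by_contra! h
      exact hσ (Equiv.ext h)
    rw [Finset.prod_eq_zero (Finset.mem_univ i), mul_zero]
    exact Matrix.one_apply_ne (Ne.symm hi)
  · simp

theorem signedDet_smul (e c : S) (A : Matrix ι ι S) :
    signedDet e (c • A) = c ^ Fintype.card ι * signedDet e A := by
  simp only [signedDet, Matrix.smul_apply, smul_eq_mul, Finset.prod_mul_distrib,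
    Finset.prod_const, Finset.card_univ, Finset.mul_sum]
  exact Finset.sum_congr rfl fun σ _ => by ring

theorem signedDet_isEmpty [IsEmpty ι] (e : S) (A : Matrix ι ι S) : signedDet e A = 1 := by
  rw [Subsingleton.elim A 1, signedDet_one]

theorem signedDet_submatrix_equiv {κ : Type*} [Fintype κ] [DecidableEq κ] (e : S) (f : κ ≃ ι)
    (A : Matrix ι ι S) : signedDet e (A.submatrix f f) = signedDet e A := by
  unfold signedDet
  refine Fintype.sum_equiv f.permCongr _ _ fun σ => ?_
  congr 1
  · simp [signOf]
  · rw [← Equiv.prod_comp f]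
    simp [Equiv.permCongr_apply]

theorem signOf_cycleRange {e : S} (he : e * e = 1) {n : ℕ} (i : Fin n) :
    signOf e i.cycleRange = e ^ (i : ℕ) := by
  have h : ∀ k : ℕ, e ^ k = if (-1 : ℤˣ) ^ k = 1 then 1 else e := by
    intro k
    rcases Nat.even_or_odd' k with ⟨l, rfl | rfl⟩
    · simp [pow_mul, pow_two, he]
    · simp [pow_succ, pow_mul, he]
  rw [h, signOf, Fin.sign_cycleRange]

/-- Laplace expansion along the first column. -/
theorem signedDet_succ_column_zero {e : S} (he : e * e = 1) {n : ℕ}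
    (A : Matrix (Fin (n + 1)) (Fin (n + 1)) S) :
    signedDet e A = ∑ i : Fin (n + 1), e ^ (i : ℕ) * A i 0 *
      signedDet e (A.submatrix i.succAbove Fin.succ) := by
  have hdet {m : ℕ} (B : Matrix (Fin m) (Fin m) S) :
      signedDet e B = ∑ σ : Equiv.Perm (Fin m), signOf e σ * ∏ i, B (σ i) i := by
    rw [← signedDet_transpose]; rfl
  rw [hdet, Finset.univ_perm_fin_succ, ← Finset.univ_product_univ]
  simp only [Finset.sum_map, Equiv.toEmbedding_apply, Finset.sum_product]
  refine Finset.sum_congr rfl fun i _ => ?_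
  rw [hdet, Finset.mul_sum]
  refine Fin.cases ?_ (fun i => ?_) i
  · refine Finset.sum_congr rfl fun σ _ => ?_
    have : signOf e (Equiv.Perm.decomposeFin.symm ((0 : Fin (n + 1)), σ)) = signOf e σ := by
      simp [signOf, Equiv.Perm.decomposeFin.symm_sign]
    rw [this, Fin.prod_univ_succ]
    simp [mul_left_comm]
  · -- composing with `i.cycleRange` makes the two embeddings of the permutations agree
    refine Fintype.sum_equiv (Equiv.mulLeft i.cycleRange) _ _ fun σ => ?_
    have hs : signOf e (Equiv.Perm.decomposeFin.symm (i.succ, σ)) = e * signOf e σ := by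
      unfold signOf
      rw [Equiv.Perm.decomposeFin.symm_sign]
      rcases Int.units_eq_one_or (Equiv.Perm.sign σ) with h | h <;> simp [h, he]
    have hp : e ^ (i : ℕ) * e ^ (i : ℕ) = 1 := by rw [← mul_pow, he, one_pow]
    rw [hs, Fin.prod_univ_succ, Equiv.coe_mulLeft, signOf_mul he, signOf_cycleRange he]
    simp only [Equiv.Perm.decomposeFin_symm_apply_zero, Equiv.Perm.decomposeFin_symm_apply_succ,
      Matrix.submatrix_apply, Equiv.Perm.mul_apply, Fin.succAbove_cycleRange, Fin.val_succ]
    generalize ∏ j, A (Equiv.swap 0 i.succ (σ j).succ) j.succ = p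
    calc _ = 1 * (e * signOf e σ * A i.succ 0 * p) := by ring
      _ = _ := by rw [← hp]; ring

end signedDet

/-! ### The transfer principle -/

/-- `a ≽° b`: the element `a` is the sum of `b` and of a balanced element `r ⊖ r`, where `e` plays
the role of `⊖ 1`. -/
def Surpasses {S : Type*} [CommSemiring S] (e a b : S) : Prop := ∃ r, a = b + (r + e * r)

namespace Surpasses

variable {S S' : Type*} [CommSemiring S] [CommSemiring S'] {e a b c d : S}

theorem refl (e a : S) : Surpasses e a a := ⟨0, by simp⟩

theorem trans (h : Surpasses e a b) (h' : Surpasses e b c) : Surpasses e a c := by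
  obtain ⟨r, rfl⟩ := h
  obtain ⟨s, rfl⟩ := h'
  exact ⟨r + s, by ring⟩

theorem add (h : Surpasses e a b) (h' : Surpasses e c d) : Surpasses e (a + c) (b + d) := by
  obtain ⟨r, rfl⟩ := h
  obtain ⟨s, rfl⟩ := h'
  exact ⟨r + s, by ring⟩

theorem mul_left (c : S) (h : Surpasses e a b) : Surpasses e (c * a) (c * b) := by
  obtain ⟨r, rfl⟩ := h
  exact ⟨c * r, by ring⟩

theorem sum {ι : Type*} (s : Finset ι) {f g : ι → S} (h : ∀ i ∈ s, Surpasses e (f i) (g i)) :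
    Surpasses e (∑ i ∈ s, f i) (∑ i ∈ s, g i) := by
  classical
  induction s using Finset.induction_on with
  | empty => exact refl _ _
  | insert i s hi ih =>
    rw [Finset.sum_insert hi, Finset.sum_insert hi]
    exact (h i (by simp)).add (ih fun j hj => h j (by simp [hj]))

theorem map (f : S →+* S') (h : Surpasses e a b) : Surpasses (f e) (f a) (f b) := by
  obtain ⟨r, rfl⟩ := h
  exact ⟨f r, by simp⟩

theorem of_isUnit_mul {u : S} (hu : IsUnit u) (h : Surpasses e (u * a) (u * b)) :
    Surpasses e a b := by
  obtain ⟨u, rfl⟩ := hu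
  simpa [← mul_assoc] using h.mul_left ((u⁻¹ : Sˣ) : S)

theorem polynomial_coeff {p q : S[X]} (h : Surpasses (C e) p q) (k : ℕ) :
    Surpasses e (p.coeff k) (q.coeff k) := by
  obtain ⟨r, rfl⟩ := h
  exact ⟨r.coeff k, by simp⟩

theorem of_mvPolynomial_coeff {σ : Type*} {p q : MvPolynomial σ S}
    (h : ∀ m, Surpasses e (p.coeff m) (q.coeff m)) : Surpasses (MvPolynomial.C e) p q := by
  classical
  choose r hr using h
  refine ⟨∑ m ∈ p.support ∪ q.support, MvPolynomial.monomial m (r m), ?_⟩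
  ext m
  have hm : MvPolynomial.coeff m (∑ m ∈ p.support ∪ q.support, MvPolynomial.monomial m (r m)) =
      if m ∈ p.support ∪ q.support then r m else 0 := by
    simp only [MvPolynomial.coeff_sum, MvPolynomial.coeff_monomial]
    exact Finset.sum_ite_eq' _ _ _
  rw [MvPolynomial.coeff_add, MvPolynomial.coeff_add, MvPolynomial.coeff_C_mul, hm]
  split_ifs with h
  · exact hr m
  · rw [Finset.mem_union, not_or, MvPolynomial.notMem_support_iff,
      MvPolynomial.notMem_support_iff] at h
    simp [h.1, h.2]

end Surpasses

/-- The semiring `ℕ[ω]` with `ω² = 1`: the initial commutative semiring with a symmetry,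
where `ω = ⊖ 1`. Its elements are the pairs `re + im ω` of natural numbers. -/
abbrev SignNat : Type := QuadraticAlgebra ℕ 1 0

namespace SignNat

/-- The element `⊖ 1` of `ℕ[ω]`. -/
def omega : SignNat := ⟨0, 1⟩

theorem omega_mul_omega : omega * omega = 1 := by
  ext <;> simp [omega, QuadraticAlgebra.re_one, QuadraticAlgebra.im_one]

variable {S : Type*} [CommSemiring S]

/-- The morphism from `ℕ[ω]` to a commutative semiring sending `ω` to a given `e` with `e² = 1`. -/
def lift (e : S) (he : e * e = 1) : SignNat →+* S where
  toFun x := x.re + x.im * e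
  map_zero' := by simp
  map_one' := by simp [QuadraticAlgebra.re_one, QuadraticAlgebra.im_one]
  map_add' x y := by simp; ring
  map_mul' x y := by
    simp only [QuadraticAlgebra.re_mul, QuadraticAlgebra.im_mul]
    push_cast
    calc _ = (x.re * y.re + x.im * y.im * 1 : S) + (x.re * y.im + x.im * y.re) * e := by ring
      _ = _ := by rw [← he]; ring

theorem lift_apply (e : S) (he : e * e = 1) (x : SignNat) : lift e he x = x.re + x.im * e := rfl

theorem lift_omega (e : S) (he : e * e = 1) : lift e he omega = e := by
  simp [lift_apply, omega]

end SignNat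

/-- `ℕ[ω][x_s : s ∈ σ]`, the free commutative semiring with symmetry on the set `σ`. -/
abbrev FreeSym (σ : Type*) : Type _ := MvPolynomial σ SignNat

namespace FreeSym

variable {σ : Type*} {S : Type*} [CommSemiring S]

/-- The element `⊖ 1` of the free commutative semiring with symmetry. -/
noncomputable def omega (σ : Type*) : FreeSym σ := MvPolynomial.C SignNat.omega

theorem omega_mul_omega : omega σ * omega σ = 1 := by
  rw [omega, ← MvPolynomial.C_mul, SignNat.omega_mul_omega, MvPolynomial.C_1]

/-- The evaluation of a formal expression at a family of elements of a commutative semiring in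
which `e` plays the role of `⊖ 1`. -/
noncomputable def eval (e : S) (he : e * e = 1) (v : σ → S) : FreeSym σ →+* S :=
  MvPolynomial.eval₂Hom (SignNat.lift e he) v

theorem eval_X (e : S) (he : e * e = 1) (v : σ → S) (s : σ) :
    eval e he v (MvPolynomial.X s) = v s := by simp [eval]

theorem eval_omega (e : S) (he : e * e = 1) (v : σ → S) : eval e he v (omega σ) = e := by
  simp [eval, omega, SignNat.lift_omega]

/-- The image of a formal expression in the polynomial ring over `ℤ`. -/
noncomputable def toInt : FreeSym σ →+* MvPolynomial σ ℤ :=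
  MvPolynomial.map (SignNat.lift (-1) (by norm_num))

theorem toInt_omega : toInt (omega σ) = -1 := by
  simp [toInt, omega, SignNat.lift_omega]

/-- No monomial occurs with both signs. -/
def IsReduced (p : FreeSym σ) : Prop := ∀ m, (p.coeff m).re = 0 ∨ (p.coeff m).im = 0

/-- The strong transfer principle: an identity between formal expressions that holds over
commutative rings gives a relation `≽°` over every commutative semiring with symmetry, as soon as
no monomial of the right-hand side occurs with both signs. -/
theorem surpasses_of_toInt_eq {p q : FreeSym σ} (h : toInt p = toInt q) (hq : q.IsReduced)
    (e : S) (he : e * e = 1) (v : σ → S) : Surpasses e (eval e he v p) (eval e he v q) := by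
  have key : Surpasses (omega σ) p q := by
    refine Surpasses.of_mvPolynomial_coeff fun m => ?_
    have hm := congrArg (MvPolynomial.coeff m) h
    simp only [toInt, MvPolynomial.coeff_map, SignNat.lift_apply] at hm
    -- the balanced part of `a + b ω` is obtained from `min a b`
    refine ⟨⟨min (p.coeff m).re (p.coeff m).im, 0⟩, ?_⟩
    ext
    · rcases hq m with h' | h' <;> simp [SignNat.omega, h'] at hm ⊢ <;> omega
    · rcases hq m with h' | h' <;> simp [SignNat.omega, h'] at hm ⊢ <;> omega
  simpa [eval_omega] using key.map (eval e he v)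

theorem eval_signedDet {ι : Type*} [Fintype ι] [DecidableEq ι] (e : S) (he : e * e = 1)
    (v : σ → S) (A : Matrix ι ι (FreeSym σ)) :
    eval e he v (signedDet (omega σ) A) = signedDet e (A.map (eval e he v)) := by
  rw [map_signedDet, eval_omega]

end FreeSym

/-! ### Schur complements -/

/-- If at each point the unordered pairs of values of `σ, τ` and of `σ', τ'` coincide, then
`σ = σ' τ⁻¹ τ'`, hence the products of signs agree. -/
theorem sign_mul_sign_eq_of_pairs {α : Type*} [Fintype α] [DecidableEq α]
    {σ τ σ' τ' : Equiv.Perm α}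
    (h : ∀ x, (σ' x = σ x ∧ τ' x = τ x) ∨ (σ' x = τ x ∧ τ' x = σ x)) :
    Equiv.Perm.sign σ * Equiv.Perm.sign τ = Equiv.Perm.sign σ' * Equiv.Perm.sign τ' := by
  have key : σ' * τ⁻¹ * τ' = σ := by
    ext x
    rw [Equiv.Perm.mul_apply, Equiv.Perm.mul_apply]
    rcases h x with ⟨h1, h2⟩ | ⟨h1, h2⟩
    · simp [h1, h2]
    · rw [h2]
      obtain ⟨y, hy⟩ := τ.surjective (σ x)
      rw [← hy, Equiv.Perm.inv_def, Equiv.symm_apply_apply]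
      rcases h y with ⟨h3, h4⟩ | ⟨h3, h4⟩
      · have : y = x := τ'.injective (by rw [h4, h2, hy])
        rw [this, h1]
      · exact h3
  rw [← key, Equiv.Perm.sign_mul, Equiv.Perm.sign_mul, Equiv.Perm.sign_inv, mul_right_comm,
    mul_assoc _ (Equiv.Perm.sign τ) (Equiv.Perm.sign τ), Int.units_mul_self, mul_one]

namespace FreeSym

variable {σ : Type*}

theorem isReduced_sum_monomial {κ : Type*} (s : Finset κ) (m : κ → σ →₀ ℕ) (c : κ → SignNat)
    (h : ∀ i ∈ s, ∀ j ∈ s, m i = m j → (c i).re = 0 ∨ (c j).im = 0) :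
    IsReduced (∑ i ∈ s, MvPolynomial.monomial (m i) (c i)) := by
  classical
  intro m₀
  by_contra! hne
  let reHom : SignNat →+ ℕ := ⟨⟨fun x => x.re, rfl⟩, fun _ _ => rfl⟩
  let imHom : SignNat →+ ℕ := ⟨⟨fun x => x.im, rfl⟩, fun _ _ => rfl⟩
  rw [MvPolynomial.coeff_sum] at hne
  obtain ⟨i, hi, hi'⟩ : ∃ i ∈ s, reHom ((MvPolynomial.monomial (m i) (c i)).coeff m₀) ≠ 0 := by
    by_contra! h0
    exact hne.1 (((map_sum reHom _ s)).trans (Finset.sum_eq_zero h0))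
  obtain ⟨j, hj, hj'⟩ : ∃ i ∈ s, imHom ((MvPolynomial.monomial (m i) (c i)).coeff m₀) ≠ 0 := by
    by_contra! h0
    exact hne.2 (((map_sum imHom _ s)).trans (Finset.sum_eq_zero h0))
  rw [MvPolynomial.coeff_monomial] at hi' hj'
  split_ifs at hi' with h1
  · split_ifs at hj' with h2
    · rcases h i hi j hj (h1.trans h2.symm) with h' | h'
      · exact hi' h'
      · exact hj' h'
    · exact hj' rfl
  · exact hi' rfl

theorem prod_X_eq_monomial {κ : Type*} [Fintype κ] (f : κ → σ) :
    (∏ i, MvPolynomial.X (f i) : FreeSym σ) =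
      MvPolynomial.monomial (∑ i, Finsupp.single (f i) 1) 1 := by
  rw [MvPolynomial.monomial_sum_one]
  rfl

theorem signOf_omega {ι : Type*} [Fintype ι] [DecidableEq ι] (π : Equiv.Perm ι) :
    signOf (omega σ) π = MvPolynomial.C (signOf SignNat.omega π) :=
  (map_signOf MvPolynomial.C _ _).symm

/-- The matrix of indeterminates. -/
noncomputable def genericMatrix (ι : Type*) : Matrix ι ι (FreeSym (ι × ι)) :=
  Matrix.of fun i j => MvPolynomial.X (i, j)

/-- In the product of a principal minor of the generic matrix with its determinant, no monomial
occurs with both signs: after extending by the identity, two pairs of permutations giving the same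
monomial satisfy `sign_mul_sign_eq_of_pairs`. -/
theorem isReduced_det_mul_det (n k : ℕ) :
    IsReduced (signedDet (omega _) (genericMatrix (Fin n ⊕ Fin k)).toBlocks₁₁ *
      signedDet (omega _) (genericMatrix (Fin n ⊕ Fin k))) := by
  classical
  have hexp : signedDet (omega _) (genericMatrix (Fin n ⊕ Fin k)).toBlocks₁₁ *
      signedDet (omega _) (genericMatrix (Fin n ⊕ Fin k)) =
      ∑ p : Equiv.Perm (Fin n) × Equiv.Perm (Fin n ⊕ Fin k), MvPolynomial.monomial
        (∑ i, Finsupp.single (Sum.inl i, Sum.inl (p.1 i)) 1 + ∑ x, Finsupp.single (x, p.2 x) 1)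
        (signOf SignNat.omega p.1 * signOf SignNat.omega p.2) := by
    rw [signedDet, signedDet, Finset.sum_mul_sum, ← Finset.univ_product_univ, Finset.sum_product]
    refine Finset.sum_congr rfl fun π _ => Finset.sum_congr rfl fun τ _ => ?_
    simp only [genericMatrix, Matrix.toBlocks₁₁, Matrix.of_apply, signOf_omega]
    rw [prod_X_eq_monomial, prod_X_eq_monomial, MvPolynomial.C_mul_monomial,
      MvPolynomial.C_mul_monomial, MvPolynomial.monomial_mul, mul_one, mul_one]
  rw [hexp]
  refine isReduced_sum_monomial _ _ _ ?_
  rintro ⟨π, τ⟩ - ⟨π', τ'⟩ - hm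
  -- adding the diagonal entries `(inr j, inr j)` extends a permutation of `Fin n` by the identity
  have hext (ρ : Equiv.Perm (Fin n)) (x y : Fin n ⊕ Fin k) :
      (∑ z, Finsupp.single (z, Equiv.Perm.sumCongr ρ (1 : Equiv.Perm (Fin k)) z) 1 :
        (Fin n ⊕ Fin k) × (Fin n ⊕ Fin k) →₀ ℕ) (x, y) =
      (∑ i, Finsupp.single (Sum.inl i, Sum.inl (ρ i)) 1 :
        (Fin n ⊕ Fin k) × (Fin n ⊕ Fin k) →₀ ℕ) (x, y) +
      (∑ j, Finsupp.single (Sum.inr j, Sum.inr j) 1 :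
        (Fin n ⊕ Fin k) × (Fin n ⊕ Fin k) →₀ ℕ) (x, y) := by
    rw [Fintype.sum_sum_type]
    simp
  have heval (ρ : Equiv.Perm (Fin n ⊕ Fin k)) (x y : Fin n ⊕ Fin k) :
      (∑ z, Finsupp.single (z, ρ z) 1 : (Fin n ⊕ Fin k) × (Fin n ⊕ Fin k) →₀ ℕ) (x, y) =
      if ρ x = y then 1 else 0 := by
    rw [Finsupp.finsetSum_apply, Finset.sum_eq_single x]
    · simp [Finsupp.single_apply]
    · intro z _ hz
      simp [hz]
    · simp
  have hcount (x y : Fin n ⊕ Fin k) :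
      ((if Equiv.Perm.sumCongr π 1 x = y then 1 else 0) + if τ x = y then 1 else 0) =
      ((if Equiv.Perm.sumCongr π' 1 x = y then 1 else 0) + if τ' x = y then 1 else 0 : ℕ) := by
    have := DFunLike.congr_fun hm (x, y)
    simp only [Finsupp.add_apply] at this
    rw [← heval, ← heval, ← heval, ← heval, hext, hext]
    omega
  have hsign := sign_mul_sign_eq_of_pairs (σ := Equiv.Perm.sumCongr π 1) (τ := τ)
    (σ' := Equiv.Perm.sumCongr π' 1) (τ' := τ') fun x => by
      have h1 := hcount x (Equiv.Perm.sumCongr π' 1 x)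
      have h2 := hcount x (τ' x)
      have h3 := hcount x (Equiv.Perm.sumCongr π 1 x)
      have h4 := hcount x (τ x)
      grind
  rw [Equiv.Perm.sign_sumCongr, Equiv.Perm.sign_sumCongr, Equiv.Perm.sign_one, mul_one,
    mul_one] at hsign
  have hs (ρ : Equiv.Perm (Fin n)) (υ : Equiv.Perm (Fin n ⊕ Fin k)) :
      signOf SignNat.omega ρ * signOf SignNat.omega υ =
      if Equiv.Perm.sign ρ * Equiv.Perm.sign υ = 1 then 1 else SignNat.omega := by
    unfold signOf
    rcases Int.units_eq_one_or (Equiv.Perm.sign ρ) with h | h <;>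
      rcases Int.units_eq_one_or (Equiv.Perm.sign υ) with h' | h' <;>
      simp [h, h', SignNat.omega_mul_omega]
  dsimp only
  rw [hs, hs, hsign]
  split_ifs
  · exact Or.inr rfl
  · exact Or.inl rfl

end FreeSym

/-- The expression obtained from the Laplace expansion of `det(det(A) U ⊖ V adj(A) H)` along the
first column when the minors are replaced by determinants of submatrices of `(A H; V U)`. -/
def schurLaplace {S : Type*} [CommSemiring S] (e : S) {n k : ℕ} (A : Matrix (Fin n) (Fin n) S)
    (H : Matrix (Fin n) (Fin (k + 1)) S) (V : Matrix (Fin (k + 1)) (Fin n) S)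
    (U : Matrix (Fin (k + 1)) (Fin (k + 1)) S) : S :=
  ∑ i : Fin (k + 1), e ^ (i : ℕ) * (signedDet e A • U + e • (V * signedAdj e A * H)) i 0 *
    signedDet e (Matrix.fromBlocks A (H.submatrix id Fin.succ) (V.submatrix i.succAbove id)
      (U.submatrix i.succAbove Fin.succ))

theorem map_schurLaplace {S S' : Type*} [CommSemiring S] [CommSemiring S'] (f : S →+* S') (e : S)
    {n k : ℕ} (A : Matrix (Fin n) (Fin n) S) (H : Matrix (Fin n) (Fin (k + 1)) S)
    (V : Matrix (Fin (k + 1)) (Fin n) S) (U : Matrix (Fin (k + 1)) (Fin (k + 1)) S) :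
    f (schurLaplace e A H V U) =
      schurLaplace (f e) (A.map f) (H.map f) (V.map f) (U.map f) := by
  have hW (x : Fin (k + 1)) : f ((V * signedAdj e A * H) x 0) =
      (V.map f * signedAdj (f e) (A.map f) * H.map f) x 0 := by
    rw [← map_signedAdj, ← Matrix.map_mul, ← Matrix.map_mul, Matrix.map_apply]
  simp [schurLaplace, map_signedDet, Matrix.fromBlocks_map, Matrix.submatrix_map, hW]

theorem schurLaplace_of_field {K : Type*} [Field K] {n k : ℕ}
    (A : Matrix (Fin n) (Fin n) K) (H : Matrix (Fin n) (Fin (k + 1)) K)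
    (V : Matrix (Fin (k + 1)) (Fin n) K) (U : Matrix (Fin (k + 1)) (Fin (k + 1)) K)
    (hA : A.det ≠ 0) :
    schurLaplace (-1) A H V U = A.det * (Matrix.fromBlocks A H V U).det := by
  simp only [schurLaplace, signedDet_neg_one, signedAdj_neg_one]
  let := A.invertibleOfIsUnitDet hA.isUnit
  have hadj : A.adjugate = A.det • ⅟A := by
    rw [Matrix.invOf_eq_nonsing_inv, Matrix.inv_def, smul_smul]
    simp [hA]
  have hW : A.det • U + (-1 : K) • (V * A.adjugate * H) = A.det • (U - V * ⅟A * H) := by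
    rw [hadj, Matrix.mul_smul, Matrix.smul_mul, smul_sub, sub_eq_add_neg, neg_one_smul]
  rw [hW, Matrix.det_fromBlocks₁₁ A H V U, Matrix.det_succ_column_zero (U - V * ⅟A * H),
    Finset.mul_sum, Finset.mul_sum]
  refine Finset.sum_congr rfl fun i _ => ?_
  rw [Matrix.det_fromBlocks₁₁]
  have hS : U.submatrix i.succAbove Fin.succ - V.submatrix i.succAbove id * ⅟A *
      H.submatrix id Fin.succ = (U - V * ⅟A * H).submatrix i.succAbove Fin.succ := by
    ext a b
    simp [Matrix.mul_apply]
  rw [hS, Matrix.smul_apply, smul_eq_mul]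
  ring

namespace FreeSym

variable {σ : Type*}

/-- The morphism from formal expressions to the field `ℚ(x_s : s ∈ σ)` sending `⊖ 1` to `-1`. -/
noncomputable def toField (σ : Type*) : FreeSym σ →+* FractionRing (MvPolynomial σ ℤ) :=
  (algebraMap (MvPolynomial σ ℤ) (FractionRing (MvPolynomial σ ℤ))).comp toInt

theorem toField_omega : toField σ (omega σ) = -1 := by
  simp [toField, toInt_omega]

theorem toInt_eq_of_toField_eq {p q : FreeSym σ} (h : toField σ p = toField σ q) :
    toInt p = toInt q :=
  IsFractionRing.injective _ _ h

theorem toField_signedDet {ι : Type*} [Fintype ι] [DecidableEq ι] (A : Matrix ι ι (FreeSym σ)) :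
    toField σ (signedDet (omega σ) A) = (A.map (toField σ)).det := by
  rw [map_signedDet, toField_omega, signedDet_neg_one]

theorem det_map_toField_ne_zero {ι : Type*} [Fintype ι] [DecidableEq ι]
    {A : Matrix ι ι (FreeSym σ)} (v : σ → ℤ)
    (hA : A.map (eval (-1) (by norm_num) v) = 1) : (A.map (toField σ)).det ≠ 0 := by
  rw [← toField_signedDet, toField, RingHom.comp_apply, ne_eq,
    FaithfulSMul.algebraMap_eq_zero_iff]
  intro h
  have hcomp : eval (-1) (by norm_num) v = (MvPolynomial.eval v).comp (toInt (σ := σ)) := by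
    ext s <;> simp [eval, toInt]
  have h1 := congrArg (MvPolynomial.eval v) h
  rw [← RingHom.comp_apply, ← hcomp, eval_signedDet, hA, signedDet_one, map_zero] at h1
  exact one_ne_zero h1

end FreeSym

section transfer

variable {S : Type*} [CommSemiring S] {e : S}

/-- Over a commutative ring both sides are equal, since `(A H; V U)` has determinant
`det(A) det(U - V A⁻¹ H)`. -/
theorem surpasses_schurLaplace (he : e * e = 1) {n k : ℕ} (A : Matrix (Fin n) (Fin n) S)
    (H : Matrix (Fin n) (Fin (k + 1)) S) (V : Matrix (Fin (k + 1)) (Fin n) S)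
    (U : Matrix (Fin (k + 1)) (Fin (k + 1)) S) :
    Surpasses e (schurLaplace e A H V U)
      (signedDet e A * signedDet e (Matrix.fromBlocks A H V U)) := by
  let Z := FreeSym.genericMatrix (Fin n ⊕ Fin (k + 1))
  let v : (Fin n ⊕ Fin (k + 1)) × (Fin n ⊕ Fin (k + 1)) → S := fun p =>
    Matrix.fromBlocks A H V U p.1 p.2
  have key := FreeSym.surpasses_of_toInt_eq
    (p := schurLaplace (FreeSym.omega _) Z.toBlocks₁₁ Z.toBlocks₁₂ Z.toBlocks₂₁ Z.toBlocks₂₂)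
    (q := signedDet (FreeSym.omega _) Z.toBlocks₁₁ * signedDet (FreeSym.omega _) Z)
    (FreeSym.toInt_eq_of_toField_eq ?_) (FreeSym.isReduced_det_mul_det n (k + 1)) e he v
  · rw [map_schurLaplace, map_mul, FreeSym.eval_signedDet, FreeSym.eval_signedDet,
      FreeSym.eval_omega] at key
    have hZ : Z.map (FreeSym.eval e he v) = Matrix.fromBlocks A H V U := by
      ext i j
      simp [Z, FreeSym.genericMatrix, FreeSym.eval_X, v]
    have h11 : Z.toBlocks₁₁.map (FreeSym.eval e he v) = A := by
      change (Z.map (FreeSym.eval e he v)).toBlocks₁₁ = A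
      rw [hZ, Matrix.toBlocks_fromBlocks₁₁]
    have h12 : Z.toBlocks₁₂.map (FreeSym.eval e he v) = H := by
      change (Z.map (FreeSym.eval e he v)).toBlocks₁₂ = H
      rw [hZ, Matrix.toBlocks_fromBlocks₁₂]
    have h21 : Z.toBlocks₂₁.map (FreeSym.eval e he v) = V := by
      change (Z.map (FreeSym.eval e he v)).toBlocks₂₁ = V
      rw [hZ, Matrix.toBlocks_fromBlocks₂₁]
    have h22 : Z.toBlocks₂₂.map (FreeSym.eval e he v) = U := by
      change (Z.map (FreeSym.eval e he v)).toBlocks₂₂ = U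
      rw [hZ, Matrix.toBlocks_fromBlocks₂₂]
    rwa [hZ, h11, h12, h21, h22] at key
  · rw [map_schurLaplace, map_mul, FreeSym.toField_signedDet, FreeSym.toField_signedDet,
      FreeSym.toField_omega, schurLaplace_of_field, ← Matrix.fromBlocks_map,
      Matrix.fromBlocks_toBlocks]
    refine FreeSym.det_map_toField_ne_zero (fun p => if p.1 = p.2 then 1 else 0) ?_
    ext i j
    simp [Z, FreeSym.genericMatrix, FreeSym.eval_X, Matrix.toBlocks₁₁, Matrix.one_apply]

/-- The tropical form of the identity `det(U - V A⁻¹ H) = det(A)⁻¹ det (A H; V U)` for the Schur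
complement; it contains Jacobi's identity for the minors of the adjoint matrix. -/
theorem surpasses_schur (he : e * e = 1) {n : ℕ} (A : Matrix (Fin n) (Fin n) S) (k : ℕ)
    (H : Matrix (Fin n) (Fin k) S) (V : Matrix (Fin k) (Fin n) S) (U : Matrix (Fin k) (Fin k) S) :
    Surpasses e
      (signedDet e A * signedDet e (signedDet e A • U + e • (V * signedAdj e A * H)))
      (signedDet e A ^ k * signedDet e (Matrix.fromBlocks A H V U)) := by
  induction k with
  | zero =>
    rw [signedDet_isEmpty e (signedDet e A • U + _), mul_one, pow_zero, one_mul]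
    convert Surpasses.refl e _
    rw [← signedDet_submatrix_equiv e (Equiv.sumEmpty (Fin n) (Fin 0)).symm]
    rfl
  | succ k ih =>
    have hsub (i : Fin (k + 1)) :
        (signedDet e A • U + e • (V * signedAdj e A * H)).submatrix i.succAbove Fin.succ =
        signedDet e A • U.submatrix i.succAbove Fin.succ +
          e • (V.submatrix i.succAbove id * signedAdj e A * H.submatrix id Fin.succ) := by
      ext a b
      simp [Matrix.mul_apply]
    have h1 : Surpasses e
        (signedDet e A * signedDet e (signedDet e A • U + e • (V * signedAdj e A * H)))
        (signedDet e A ^ k * schurLaplace e A H V U) := by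
      rw [signedDet_succ_column_zero he, schurLaplace, Finset.mul_sum, Finset.mul_sum]
      refine Surpasses.sum _ fun i _ => ?_
      rw [hsub, mul_left_comm, mul_left_comm (signedDet e A ^ k)]
      exact (ih _ _ _).mul_left _
    have h2 := (surpasses_schurLaplace he A H V U).mul_left (signedDet e A ^ k)
    rw [← mul_assoc, ← pow_succ] at h2
    exact h1.trans h2

end transfer

/-! ### The generic characteristic polynomial -/

section expansion

variable {S : Type*} [CommSemiring S]

theorem signedDet_smul_one_add_smul (e y w : S) {n : ℕ} (A : Matrix (Fin n) (Fin n) S) :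
    signedDet e (y • (1 : Matrix (Fin n) (Fin n) S) + w • A) =
      ∑ σ : Equiv.Perm (Fin n), ∑ t : Finset (Fin n),
        signOf e σ * (∏ i ∈ t, (1 : Matrix (Fin n) (Fin n) S) i (σ i)) * (∏ i ∈ tᶜ, A i (σ i)) *
          (y ^ t.card * w ^ tᶜ.card) := by
  simp only [signedDet, Matrix.add_apply, Matrix.smul_apply, smul_eq_mul, Fintype.prod_add,
    Finset.mul_sum, Finset.prod_mul_distrib, Finset.prod_const]
  exact Finset.sum_congr rfl fun σ _ => Finset.sum_congr rfl fun t _ => by ring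

end expansion

/-- The indeterminates of the generic expression `det(E) det(Y I ⊕ W A)`. -/
inductive CharVar (n : ℕ) : Type
  /-- an entry of `E` -/
  | left (i j : Fin n) : CharVar n
  /-- an entry of `A` -/
  | right (i j : Fin n) : CharVar n
  /-- the indeterminate `Y` -/
  | shift : CharVar n
  /-- the indeterminate `W` -/
  | scale : CharVar n

namespace FreeSym

/-- Every monomial occurs at most once, with one sign. -/
def IsSimple {σ : Type*} (p : FreeSym σ) : Prop :=
  ∀ m, p.coeff m = 0 ∨ p.coeff m = 1 ∨ p.coeff m = SignNat.omega

theorem IsSimple.isReduced {σ : Type*} {p : FreeSym σ} (h : p.IsSimple) : p.IsReduced := by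
  intro m
  rcases h m with h | h | h <;> rw [h]
  · exact Or.inl rfl
  · exact Or.inr rfl
  · exact Or.inl rfl

theorem isSimple_sum_monomial {σ κ : Type*} (s : Finset κ) (m : κ → σ →₀ ℕ) (c : κ → SignNat)
    (hc : ∀ i ∈ s, c i = 0 ∨ c i = 1 ∨ c i = SignNat.omega)
    (h : ∀ i ∈ s, ∀ j ∈ s, c i ≠ 0 → c j ≠ 0 → m i = m j → i = j) :
    IsSimple (∑ i ∈ s, MvPolynomial.monomial (m i) (c i)) := by
  classical
  intro m₀
  simp only [MvPolynomial.coeff_sum, MvPolynomial.coeff_monomial]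
  by_cases hex : ∃ i ∈ s, c i ≠ 0 ∧ m i = m₀
  · obtain ⟨i, hi, hci, rfl⟩ := hex
    rw [Finset.sum_eq_single i]
    · rw [if_pos rfl]
      exact hc i hi
    · intro j hj hji
      split_ifs with hm
      · by_contra hcj
        exact hji (h j hj i hi hcj hci hm)
      · rfl
    · exact fun h' => absurd hi h'
  · left
    refine Finset.sum_eq_zero fun i hi => ?_
    split_ifs with hm
    · by_contra hci
      exact hex ⟨i, hi, hci, hm⟩
    · rfl

/-- The generic matrix `E`. -/
noncomputable def leftMatrix (n : ℕ) : Matrix (Fin n) (Fin n) (FreeSym (CharVar n)) :=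
  Matrix.of fun i j => MvPolynomial.X (.left i j)

/-- The generic matrix `A`. -/
noncomputable def rightMatrix (n : ℕ) : Matrix (Fin n) (Fin n) (FreeSym (CharVar n)) :=
  Matrix.of fun i j => MvPolynomial.X (.right i j)

/-- The expression `det(E) det(Y I ⊕ W A)` for generic `E`, `A`, `Y` and `W`. -/
noncomputable def genericChar (n : ℕ) : FreeSym (CharVar n) :=
  signedDet (omega _) (leftMatrix n) * signedDet (omega _)
    ((MvPolynomial.X .shift : FreeSym (CharVar n)) • (1 : Matrix (Fin n) (Fin n) _) +
      (MvPolynomial.X .scale : FreeSym (CharVar n)) • rightMatrix n)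

theorem signOf_eq_or {ι : Type*} [Fintype ι] [DecidableEq ι] (π : Equiv.Perm ι) :
    signOf SignNat.omega π = 1 ∨ signOf SignNat.omega π = SignNat.omega := by
  unfold signOf
  split_ifs <;> simp

/-- Expanding the product gives one term for each permutation of the rows of `E`, each permutation
`σ` of the rows of `A` and each set `t` of points fixed by `σ` at which `Y` is chosen; all three can
be read off the monomial. -/
theorem isSimple_genericChar (n : ℕ) : IsSimple (genericChar n) := by
  classical
  let mon : Equiv.Perm (Fin n) × Equiv.Perm (Fin n) × Finset (Fin n) → CharVar n →₀ ℕ := fun p =>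
    ∑ i, Finsupp.single (.left i (p.1 i)) 1 + (∑ i ∈ p.2.2ᶜ, Finsupp.single (.right i (p.2.1 i)) 1 +
      (Finsupp.single .shift p.2.2.card + Finsupp.single .scale p.2.2ᶜ.card))
  let c : Equiv.Perm (Fin n) × Equiv.Perm (Fin n) × Finset (Fin n) → SignNat := fun p =>
    if ∀ i ∈ p.2.2, p.2.1 i = i then signOf SignNat.omega p.1 * signOf SignNat.omega p.2.1 else 0
  have hone (σ : Equiv.Perm (Fin n)) (t : Finset (Fin n)) :
      ∏ i ∈ t, (1 : Matrix (Fin n) (Fin n) (FreeSym (CharVar n))) i (σ i) =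
        MvPolynomial.C (if ∀ i ∈ t, σ i = i then 1 else 0) := by
    split_ifs with h
    · rw [MvPolynomial.C_1]
      exact Finset.prod_eq_one fun i hi => by rw [h i hi, Matrix.one_apply_eq]
    · push Not at h
      obtain ⟨i, hi, hne⟩ := h
      rw [MvPolynomial.C_0]
      exact Finset.prod_eq_zero hi (Matrix.one_apply_ne hne.symm)
  have hexp : genericChar n = ∑ p, MvPolynomial.monomial (mon p) (c p) := by
    rw [genericChar, signedDet_smul_one_add_smul, signedDet, Finset.sum_mul_sum,
      ← Finset.univ_product_univ, Finset.sum_product]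
    refine Finset.sum_congr rfl fun π _ => ?_
    rw [← Finset.univ_product_univ, Finset.sum_product]
    refine Finset.sum_congr rfl fun σ _ => ?_
    rw [Finset.mul_sum]
    refine Finset.sum_congr rfl fun t _ => ?_
    rw [hone]
    simp only [leftMatrix, rightMatrix, Matrix.of_apply, signOf_omega]
    rw [prod_X_eq_monomial, MvPolynomial.X_pow_eq_monomial, MvPolynomial.X_pow_eq_monomial]
    have : ∏ i ∈ tᶜ, (MvPolynomial.X (.right i (σ i)) : FreeSym (CharVar n)) =
        MvPolynomial.monomial (∑ i ∈ tᶜ, Finsupp.single (.right i (σ i)) 1) 1 := by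
      rw [MvPolynomial.monomial_sum_one]
      rfl
    rw [this, ← MvPolynomial.C_mul, MvPolynomial.C_mul_monomial, MvPolynomial.C_mul_monomial,
      MvPolynomial.monomial_mul, MvPolynomial.monomial_mul, MvPolynomial.monomial_mul]
    congr 1
    simp [c]
  rw [hexp]
  refine isSimple_sum_monomial _ _ _ ?_ ?_
  · rintro ⟨π, σ, t⟩ -
    simp only [c]
    split_ifs
    · rcases signOf_eq_or π with h | h <;> rcases signOf_eq_or σ with h' | h' <;>
        simp [h, h', SignNat.omega_mul_omega]
    · exact Or.inl rfl
  · rintro ⟨π, σ, t⟩ - ⟨π', σ', t'⟩ - hc hc' hm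
    have hfix : ∀ i ∈ t, σ i = i := by
      by_contra h
      exact hc (if_neg h)
    have hfix' : ∀ i ∈ t', σ' i = i := by
      by_contra h
      exact hc' (if_neg h)
    have hleft (p) (i j : Fin n) : mon p (.left i j) = if p.1 i = j then 1 else 0 := by
      simp only [mon, Finsupp.add_apply, Finsupp.finsetSum_apply, Finsupp.single_apply]
      simp [ite_and]
    have hright (p) (i j : Fin n) :
        mon p (.right i j) = if i ∉ p.2.2 ∧ p.2.1 i = j then 1 else 0 := by
      simp only [mon, Finsupp.add_apply, Finsupp.finsetSum_apply, Finsupp.single_apply]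
      simp [ite_and]
    have hπ : π = π' := by
      ext1 i
      have := DFunLike.congr_fun hm (.left i (π i))
      rw [hleft, hleft] at this
      simp only [if_true] at this
      split_ifs at this with h
      exact h.symm
    have hright' (i j : Fin n) : (i ∉ t ∧ σ i = j) ↔ (i ∉ t' ∧ σ' i = j) := by
      have := DFunLike.congr_fun hm (.right i j)
      rw [hright, hright] at this
      dsimp only at this
      split_ifs at this <;> tauto
    have ht : t = t' := by
      ext i
      have h1 := hright' i (σ i)
      have h2 := hright' i (σ' i)
      tauto
    have hσ : σ = σ' := by
      ext1 i
      by_cases hi : i ∈ t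
      · rw [hfix i hi, hfix' i (ht ▸ hi)]
      · exact (((hright' i (σ i)).1 ⟨hi, rfl⟩).2).symm
    rw [hπ, ht, hσ]

/-- The specialization of the generic `E`, `A`, `Y` and `W`. -/
def charVal {S : Type*} {n : ℕ} (E A : Matrix (Fin n) (Fin n) S) (y w : S) : CharVar n → S
  | .left i j => E i j
  | .right i j => A i j
  | .shift => y
  | .scale => w

section

variable {S : Type*} [CommSemiring S] {e : S} (he : e * e = 1) {n : ℕ}
  (E A : Matrix (Fin n) (Fin n) S) (y w : S)

theorem map_eval_leftMatrix : (leftMatrix n).map (eval e he (charVal E A y w)) = E := by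
  ext i j
  simp [leftMatrix, eval_X, charVal]

theorem map_eval_rightMatrix : (rightMatrix n).map (eval e he (charVal E A y w)) = A := by
  ext i j
  simp [rightMatrix, eval_X, charVal]

end

theorem map_smul_one_add_smul {S S' : Type*} [CommSemiring S] [CommSemiring S'] (f : S →+* S')
    {n : ℕ} (y w : S) (A : Matrix (Fin n) (Fin n) S) :
    (y • (1 : Matrix (Fin n) (Fin n) S) + w • A).map f =
      f y • (1 : Matrix (Fin n) (Fin n) S') + f w • A.map f := by
  ext i j
  simp [Matrix.one_apply, apply_ite f]

theorem eval_genericChar {S : Type*} [CommSemiring S] {e : S} (he : e * e = 1) {n : ℕ}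
    (E A : Matrix (Fin n) (Fin n) S) (y w : S) :
    eval e he (charVal E A y w) (genericChar n) =
      signedDet e E * signedDet e (y • (1 : Matrix (Fin n) (Fin n) S) + w • A) := by
  rw [genericChar, map_mul, eval_signedDet, eval_signedDet, map_eval_leftMatrix,
    map_smul_one_add_smul, map_eval_rightMatrix, eval_X, eval_X]
  rfl

theorem toField_genericChar (n : ℕ) : toField (CharVar n) (genericChar n) =
    ((leftMatrix n).map (toField (CharVar n))).det *
      (toField (CharVar n) (MvPolynomial.X CharVar.shift) •
          (1 : Matrix (Fin n) (Fin n) (FractionRing (MvPolynomial (CharVar n) ℤ))) +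
        toField (CharVar n) (MvPolynomial.X CharVar.scale) •
          (rightMatrix n).map (toField (CharVar n))).det := by
  rw [genericChar, map_mul, toField_signedDet, toField_signedDet, map_smul_one_add_smul]

theorem det_leftMatrix_ne_zero (n : ℕ) : ((leftMatrix n).map (toField _)).det ≠ 0 :=
  det_map_toField_ne_zero _ (map_eval_leftMatrix _ 1 1 0 0)

theorem det_rightMatrix_ne_zero (n : ℕ) : ((rightMatrix n).map (toField _)).det ≠ 0 :=
  det_map_toField_ne_zero _ (map_eval_rightMatrix _ 1 1 0 0)

end FreeSym

section blocks

variable {S S' : Type*} [CommSemiring S] [CommSemiring S'] {n : ℕ}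

/-- The block matrix `(E, ⊖ w A E; I, y I)`. -/
def conjBlocks (e : S) (E A : Matrix (Fin n) (Fin n) S) (y w : S) :
    Matrix (Fin n ⊕ Fin n) (Fin n ⊕ Fin n) S :=
  Matrix.fromBlocks E ((e * w) • (A * E)) 1 (y • (1 : Matrix (Fin n) (Fin n) S))

/-- The block matrix `(A, ⊖ y I; I, w I)`. -/
def invBlocks (e : S) (A : Matrix (Fin n) (Fin n) S) (y w : S) :
    Matrix (Fin n ⊕ Fin n) (Fin n ⊕ Fin n) S :=
  Matrix.fromBlocks A ((e * y) • (1 : Matrix (Fin n) (Fin n) S)) 1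
    (w • (1 : Matrix (Fin n) (Fin n) S))

theorem map_conjBlocks (f : S →+* S') (e : S) (E A : Matrix (Fin n) (Fin n) S) (y w : S) :
    (conjBlocks e E A y w).map f = conjBlocks (f e) (E.map f) (A.map f) (f y) (f w) := by
  rw [conjBlocks, conjBlocks, Matrix.fromBlocks_map, ← Matrix.map_mul]
  congr 1
  · ext i j
    rw [Matrix.map_apply, Matrix.smul_apply, Matrix.smul_apply, Matrix.map_apply, smul_eq_mul,
      smul_eq_mul, map_mul, map_mul]
  · ext i j; simp [Matrix.one_apply, apply_ite f]
  · ext i j; simp [Matrix.one_apply, apply_ite f]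

theorem map_invBlocks (f : S →+* S') (e : S) (A : Matrix (Fin n) (Fin n) S) (y w : S) :
    (invBlocks e A y w).map f = invBlocks (f e) (A.map f) (f y) (f w) := by
  rw [invBlocks, invBlocks, Matrix.fromBlocks_map]
  congr 1 <;> ext i j <;> simp [Matrix.one_apply, apply_ite f]

end blocks

section field

variable {K : Type*} [Field K] {n : ℕ}

theorem det_conjBlocks (E A : Matrix (Fin n) (Fin n) K) (y w : K) (hE : E.det ≠ 0) :
    (conjBlocks (-1) E A y w).det =
      E.det * (y • (1 : Matrix (Fin n) (Fin n) K) + w • A).det := by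
  let := E.invertibleOfIsUnitDet hE.isUnit
  rw [conjBlocks, Matrix.det_fromBlocks₁₁]
  have h : y • (1 : Matrix (Fin n) (Fin n) K) - 1 * ⅟E * ((-1 * w) • (A * E)) =
      ⅟E * (y • (1 : Matrix (Fin n) (Fin n) K) + w • A) * E := by
    simp only [Matrix.mul_add, Matrix.add_mul, Matrix.mul_smul, Matrix.smul_mul, Matrix.mul_one,
      invOf_mul_self, Matrix.one_mul, neg_one_mul, neg_smul, Matrix.mul_neg, sub_neg_eq_add,
      Matrix.mul_assoc]
  rw [h, Matrix.det_mul, Matrix.det_mul, mul_right_comm, ← Matrix.det_mul, invOf_mul_self,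
    Matrix.det_one, one_mul]

theorem det_invBlocks (A : Matrix (Fin n) (Fin n) K) (y w : K) (hA : A.det ≠ 0) :
    (invBlocks (-1) A y w).det =
      (y • (1 : Matrix (Fin n) (Fin n) K) + w • A).det := by
  let := A.invertibleOfIsUnitDet hA.isUnit
  rw [invBlocks, Matrix.det_fromBlocks₁₁, ← Matrix.det_mul]
  congr 1
  rw [Matrix.mul_sub, Matrix.one_mul, Matrix.mul_smul, Matrix.mul_smul, Matrix.mul_smul,
    Matrix.mul_one, Matrix.mul_one, mul_invOf_self, neg_one_mul, neg_smul, sub_neg_eq_add, add_comm]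

end field

section transfer

variable {S : Type*} [CommSemiring S] {e : S} {n : ℕ}

/-- Over a commutative ring both sides are equal, because
`y I + E⁻¹ (w A) E = E⁻¹ (y I + w A) E`. -/
theorem surpasses_conjBlocks (he : e * e = 1) (E A : Matrix (Fin n) (Fin n) S) (y w : S) :
    Surpasses e
      (signedDet e (conjBlocks e E A y w))
      (signedDet e E * signedDet e (y • (1 : Matrix (Fin n) (Fin n) S) + w • A)) := by
  have key := FreeSym.surpasses_of_toInt_eq
    (p := signedDet (FreeSym.omega _) (conjBlocks (FreeSym.omega _) (FreeSym.leftMatrix n)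
        (FreeSym.rightMatrix n) (MvPolynomial.X .shift) (MvPolynomial.X .scale)))
    (q := FreeSym.genericChar n)
    (FreeSym.toInt_eq_of_toField_eq ?_) (FreeSym.isSimple_genericChar n).isReduced e he
    (FreeSym.charVal E A y w)
  · rwa [FreeSym.eval_genericChar, FreeSym.eval_signedDet, map_conjBlocks,
      FreeSym.map_eval_leftMatrix,
      FreeSym.map_eval_rightMatrix, FreeSym.eval_omega, FreeSym.eval_X, FreeSym.eval_X] at key
  · rw [FreeSym.toField_genericChar, FreeSym.toField_signedDet, map_conjBlocks,
      FreeSym.toField_omega,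
      det_conjBlocks _ _ _ _ (FreeSym.det_leftMatrix_ne_zero n)]

/-- Over a commutative ring both sides are equal, because `det(A) det(w I + y A⁻¹)` is
`det(y I + w A)`. -/
theorem surpasses_invBlocks (he : e * e = 1) (A : Matrix (Fin n) (Fin n) S) (y w : S) :
    Surpasses e
      (signedDet e (invBlocks e A y w))
      (signedDet e (y • (1 : Matrix (Fin n) (Fin n) S) + w • A)) := by
  -- the factor `det(E)` is harmless: it becomes `1` for `E = I`
  have key := FreeSym.surpasses_of_toInt_eq
    (p := signedDet (FreeSym.omega _) (FreeSym.leftMatrix n) *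
      signedDet (FreeSym.omega _) (invBlocks (FreeSym.omega _) (FreeSym.rightMatrix n)
        (MvPolynomial.X .shift) (MvPolynomial.X .scale)))
    (q := FreeSym.genericChar n)
    (FreeSym.toInt_eq_of_toField_eq ?_) (FreeSym.isSimple_genericChar n).isReduced e he
    (FreeSym.charVal 1 A y w)
  · rwa [FreeSym.eval_genericChar, map_mul, FreeSym.eval_signedDet, FreeSym.eval_signedDet,
      map_invBlocks, FreeSym.map_eval_leftMatrix, FreeSym.map_eval_rightMatrix, FreeSym.eval_omega,
      FreeSym.eval_X, FreeSym.eval_X, signedDet_one, one_mul, one_mul] at key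
  · rw [FreeSym.toField_genericChar, map_mul, FreeSym.toField_signedDet,
      FreeSym.toField_signedDet, map_invBlocks, FreeSym.toField_omega,
      det_invBlocks _ _ _ (FreeSym.det_rightMatrix_ne_zero n)]

end transfer

/-! ### Characteristic polynomials of quasi-inverses and conjugates -/

section charpoly

variable {S : Type*} [CommSemiring S]

/-- The coefficient of `y^k w^(n-k)` in `det(y I ⊕ w A)`: the sum of the principal minors of `A` of
size `n - k`. -/
def charCoeff (e : S) {n : ℕ} (A : Matrix (Fin n) (Fin n) S) (k : ℕ) : S :=
  ∑ σ : Equiv.Perm (Fin n), ∑ t ∈ Finset.powersetCard k Finset.univ,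
    signOf e σ * (∏ i ∈ t, (1 : Matrix (Fin n) (Fin n) S) i (σ i)) * ∏ i ∈ tᶜ, A i (σ i)

theorem map_charCoeff {S' : Type*} [CommSemiring S'] (f : S →+* S') (e : S) {n : ℕ}
    (A : Matrix (Fin n) (Fin n) S) (k : ℕ) :
    f (charCoeff e A k) = charCoeff (f e) (A.map f) k := by
  simp [charCoeff, map_prod, map_signOf, Matrix.one_apply, apply_ite f]

theorem signedDet_eq_sum_charCoeff (e y w : S) {n : ℕ} (A : Matrix (Fin n) (Fin n) S) :
    signedDet e (y • (1 : Matrix (Fin n) (Fin n) S) + w • A) =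
      ∑ k ∈ Finset.range (n + 1), charCoeff e A k * (y ^ k * w ^ (n - k)) := by
  rw [signedDet_smul_one_add_smul]
  simp only [charCoeff, Finset.sum_mul]
  rw [Finset.sum_comm (s := Finset.range (n + 1))]
  refine Finset.sum_congr rfl fun σ _ => ?_
  rw [← Finset.powerset_univ, Finset.sum_powerset, Finset.card_univ, Fintype.card_fin]
  refine Finset.sum_congr rfl fun k _ => Finset.sum_congr rfl fun t ht => ?_
  rw [Finset.card_compl, (Finset.mem_powersetCard.1 ht).2, Fintype.card_fin]

theorem map_C_smul {n : ℕ} (c : S) (A : Matrix (Fin n) (Fin n) S) :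
    (c • A).map C = C c • A.map C := by
  ext1 i j
  simp

variable [Symmetry S]

theorem sym_one_mul (a : S) : Symmetry.sym (1 : S) * a = Symmetry.sym a := by
  rw [← Symmetry.sym_mul_left, one_mul]

theorem sym_one_mul_self : Symmetry.sym (1 : S) * Symmetry.sym 1 = 1 := by
  rw [sym_one_mul, Symmetry.sym_sym]

theorem isUnit_sym_one : IsUnit (Symmetry.sym (1 : S)) :=
  IsUnit.of_mul_eq_one _ sym_one_mul_self

theorem C_sym_one_mul_self : C (Symmetry.sym (1 : S)) * C (Symmetry.sym 1) = 1 := by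
  rw [← C_mul, sym_one_mul_self, C_1]

theorem det_eq_signedDet {n : ℕ} (A : Matrix (Fin n) (Fin n) S) :
    det A = signedDet (Symmetry.sym 1) A := rfl

theorem adj_eq_signedAdj {n : ℕ} (A : Matrix (Fin n) (Fin n) S) :
    adj A = signedAdj (Symmetry.sym 1) A := by
  cases n <;> rfl

theorem charpoly_eq_signedDet {n : ℕ} (A : Matrix (Fin n) (Fin n) S) :
    charpoly A = signedDet (C (Symmetry.sym 1))
      ((X : S[X]) • (1 : Matrix (Fin n) (Fin n) S[X]) + C (Symmetry.sym (1 : S)) • A.map C) := by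
  have hs : Symmetry.sym (1 : S[X]) = C (Symmetry.sym 1) := mul_one _
  rw [charpoly, det_eq_signedDet, hs]
  congr 1
  ext1 i j
  simp only [Matrix.of_apply, Matrix.add_apply, Matrix.smul_apply, Matrix.map_apply, smul_eq_mul,
    Matrix.one_apply, mul_ite, mul_one, mul_zero]
  rfl

theorem smul_quasiInv {n : ℕ} {E : Matrix (Fin n) (Fin n) S} (hE : Nonsingular E) :
    det E • quasiInv E = adj E := by
  rw [quasiInv, smul_smul, Ring.mul_inverse_cancel _ hE, one_smul]

/-- The polynomial `det(X A ⊖ I)`, up to a sign the reversed characteristic polynomial. -/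
noncomputable def revCharpoly {n : ℕ} (A : Matrix (Fin n) (Fin n) S) : S[X] :=
  signedDet (C (Symmetry.sym 1))
    (C (Symmetry.sym (1 : S)) • (1 : Matrix (Fin n) (Fin n) S[X]) + (X : S[X]) • A.map C)

/-- The characteristic polynomial of `E^∇ A E` surpasses that of `A`, over every commutative
semiring with symmetry. -/
theorem surpasses_charpoly_conj {n : ℕ} {E : Matrix (Fin n) (Fin n) S} (hE : Nonsingular E)
    (A : Matrix (Fin n) (Fin n) S) :
    Surpasses (C (Symmetry.sym 1)) (charpoly (quasiInv E * A * E)) (charpoly A) := by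
  have hce := C_sym_one_mul_self (S := S)
  have hD : signedDet (C (Symmetry.sym 1)) (E.map C) = C (det E) := (map_signedDet C _ _).symm
  have hU : IsUnit (C (det E)) := hE.map C
  -- the Schur complement relation for the block matrix `(E, A E; I, X I)`
  have h1 := surpasses_schur hce (E.map C) n (A.map C * E.map C) 1
    ((X : S[X]) • (1 : Matrix (Fin n) (Fin n) S[X]))
  have h2 := surpasses_conjBlocks hce (E.map C) (A.map C) X (C (Symmetry.sym (1 : S)))
  rw [conjBlocks, hce, one_smul, ← charpoly_eq_signedDet] at h2
  have hM : C (det E) • ((X : S[X]) • (1 : Matrix (Fin n) (Fin n) S[X])) +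
      C (Symmetry.sym (1 : S)) • (1 * signedAdj (C (Symmetry.sym (1 : S))) (E.map C) *
        (A.map C * E.map C)) =
      C (det E) • ((X : S[X]) • (1 : Matrix (Fin n) (Fin n) S[X]) +
        C (Symmetry.sym (1 : S)) • (quasiInv E * A * E).map C) := by
    rw [smul_add, smul_comm (C (det E)) (C (Symmetry.sym (1 : S))), ← map_C_smul,
      Matrix.mul_assoc (quasiInv E), ← Matrix.smul_mul (det E), smul_quasiInv hE, adj_eq_signedAdj,
      ← map_signedAdj, Matrix.map_mul, Matrix.map_mul, Matrix.one_mul]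
  rw [hD, hM, signedDet_smul, ← charpoly_eq_signedDet, Fintype.card_fin] at h1
  rw [hD] at h2
  have h3 := h1.trans (h2.mul_left (C (det E) ^ n))
  rw [mul_left_comm] at h3
  exact (h3.of_isUnit_mul (hU.pow n)).of_isUnit_mul hU

/-- Over every commutative semiring with symmetry, `det(A) f_{A^∇}` surpasses the reversed
characteristic polynomial of `A`. -/
theorem surpasses_charpoly_quasiInv {n : ℕ} {A : Matrix (Fin n) (Fin n) S} (hA : Nonsingular A) :
    Surpasses (C (Symmetry.sym 1)) (C (det A) * charpoly (quasiInv A)) (revCharpoly A) := by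
  have hce := C_sym_one_mul_self (S := S)
  have hD : signedDet (C (Symmetry.sym 1)) (A.map C) = C (det A) := (map_signedDet C _ _).symm
  have hU : IsUnit (C (det A)) := hA.map C
  -- the Schur complement relation for the block matrix `(A, I; I, X I)`
  have h1 := surpasses_schur hce (A.map C) n 1 1
    ((X : S[X]) • (1 : Matrix (Fin n) (Fin n) S[X]))
  have h2 := surpasses_invBlocks hce (A.map C) (C (Symmetry.sym (1 : S))) X
  rw [invBlocks, hce, one_smul] at h2
  have hM : C (det A) • ((X : S[X]) • (1 : Matrix (Fin n) (Fin n) S[X])) +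
      C (Symmetry.sym (1 : S)) • (1 * signedAdj (C (Symmetry.sym (1 : S))) (A.map C) * 1) =
      C (det A) • ((X : S[X]) • (1 : Matrix (Fin n) (Fin n) S[X]) +
        C (Symmetry.sym (1 : S)) • (quasiInv A).map C) := by
    rw [smul_add, smul_comm (C (det A)) (C (Symmetry.sym (1 : S))), ← map_C_smul,
      smul_quasiInv hA, adj_eq_signedAdj, ← map_signedAdj, Matrix.one_mul, Matrix.mul_one]
  rw [hD, hM, signedDet_smul, ← charpoly_eq_signedDet, Fintype.card_fin] at h1
  have h3 := h1.trans (h2.mul_left (C (det A) ^ n))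
  rw [mul_left_comm] at h3
  exact h3.of_isUnit_mul (hU.pow n)

theorem eval_charpoly {n : ℕ} (A : Matrix (Fin n) (Fin n) S) (r : S) :
    (charpoly A).eval r = signedDet (Symmetry.sym 1)
      (r • (1 : Matrix (Fin n) (Fin n) S) + Symmetry.sym (1 : S) • A) := by
  have hA : (A.map C).map (evalRingHom r) = A := by ext; simp
  rw [charpoly_eq_signedDet, ← coe_evalRingHom, map_signedDet, FreeSym.map_smul_one_add_smul, hA]
  simp

theorem eval_revCharpoly {n : ℕ} (A : Matrix (Fin n) (Fin n) S) (r : S) :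
    (revCharpoly A).eval r = signedDet (Symmetry.sym 1)
      (Symmetry.sym (1 : S) • (1 : Matrix (Fin n) (Fin n) S) + r • A) := by
  have hA : (A.map C).map (evalRingHom r) = A := by ext; simp
  rw [revCharpoly, ← coe_evalRingHom, map_signedDet, FreeSym.map_smul_one_add_smul, hA]
  simp

theorem coeff_charpoly {n : ℕ} (A : Matrix (Fin n) (Fin n) S) (k : ℕ) :
    (charpoly A).coeff k =
      if k ≤ n then charCoeff (Symmetry.sym 1) A k * Symmetry.sym 1 ^ (n - k) else 0 := by
  rw [charpoly_eq_signedDet, signedDet_eq_sum_charCoeff]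
  simp only [← map_charCoeff, ← C_pow, finsetSum_coeff, coeff_C_mul, coeff_mul_C, coeff_X_pow]
  simp

theorem coeff_revCharpoly {n : ℕ} (A : Matrix (Fin n) (Fin n) S) (k : ℕ) :
    (revCharpoly A).coeff k =
      if k ≤ n then charCoeff (Symmetry.sym 1) A (n - k) * Symmetry.sym 1 ^ (n - k) else 0 := by
  rw [revCharpoly, signedDet_eq_sum_charCoeff, ← Finset.sum_range_reflect]
  simp only [← map_charCoeff, ← C_pow, finsetSum_coeff, coeff_C_mul, coeff_X_pow]
  rw [Finset.sum_congr rfl (g := fun j => if k = j then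
    charCoeff (Symmetry.sym 1) A (n - j) * Symmetry.sym 1 ^ (n - j) else 0)]
  · simp
  · intro j hj
    rw [Finset.mem_range] at hj
    have h1 : n + 1 - 1 - j = n - j := by omega
    have h2 : n - (n - j) = j := by omega
    rw [h1, h2]
    split_ifs <;> simp

theorem coeff_charpoly_sub {n : ℕ} (A : Matrix (Fin n) (Fin n) S) {k : ℕ} (hk : k ≤ n) :
    (charpoly A).coeff (n - k) = Symmetry.sym 1 ^ n * (revCharpoly A).coeff k := by
  rw [coeff_charpoly, coeff_revCharpoly, if_pos (Nat.sub_le n k), if_pos hk, Nat.sub_sub_self hk]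
  have h : (Symmetry.sym 1 : S) ^ k = Symmetry.sym 1 ^ n * Symmetry.sym 1 ^ (n - k) := by
    obtain ⟨j, rfl⟩ := Nat.exists_eq_add_of_le hk
    rw [Nat.add_sub_cancel_left, pow_add, mul_assoc, ← mul_pow, sym_one_mul_self, one_pow, mul_one]
  rw [h]
  ring

theorem eval_charpoly_inv {n : ℕ} (A : Matrix (Fin n) (Fin n) S) (u : Sˣ) :
    (charpoly A).eval ((u⁻¹ : Sˣ) : S) =
      (Symmetry.sym 1 * ((u⁻¹ : Sˣ) : S)) ^ n * (revCharpoly A).eval (u : S) := by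
  rw [eval_charpoly, eval_revCharpoly]
  have h := signedDet_smul (Symmetry.sym 1) (Symmetry.sym 1 * ((u⁻¹ : Sˣ) : S))
    (Symmetry.sym (1 : S) • (1 : Matrix (Fin n) (Fin n) S) + (u : S) • A)
  rw [Fintype.card_fin] at h
  rw [← h]
  congr 1
  rw [smul_add, smul_smul, smul_smul, mul_right_comm, sym_one_mul_self, one_mul, mul_assoc,
    Units.inv_mul, mul_one]

end charpoly

/-! ### Roots and corner roots -/

section roots

theorem natLE_sum_eval {S : Type*} [CommSemiring S] (p : S[X]) (r : S) (K : Finset ℕ)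
    (hK : ∀ k ∈ K, k ≤ p.natDegree) :
    NatLE (∑ k ∈ K, p.coeff k * r ^ k) (p.eval r) := by
  have hsub : K ⊆ Finset.range (p.natDegree + 1) := fun k hk =>
    Finset.mem_range.2 (Nat.lt_succ_of_le (hK k hk))
  refine ⟨∑ k ∈ Finset.range (p.natDegree + 1) \ K, p.coeff k * r ^ k, ?_⟩
  rw [eval_eq_sum_range, ← Finset.sum_sdiff hsub, add_comm]

variable {T : Type*} [CommSemiring T] [Symmetry T]

theorem bal_eq (a : T) : bal a = a + Symmetry.sym 1 * a := by rw [bal, sym_one_mul]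

theorem bal_mem_balSet (a : T) : bal a ∈ balSet T := ⟨a, rfl⟩

theorem add_mem_balSet {a b : T} (ha : a ∈ balSet T) (hb : b ∈ balSet T) : a + b ∈ balSet T := by
  obtain ⟨x, rfl⟩ := ha
  obtain ⟨y, rfl⟩ := hb
  exact ⟨x + y, by simp only [bal_eq]; ring⟩

theorem mul_mem_balSet (c : T) {a : T} (ha : a ∈ balSet T) : c * a ∈ balSet T := by
  obtain ⟨x, rfl⟩ := ha
  exact ⟨c * x, by simp only [bal_eq]; ring⟩

theorem mem_balSet_of_unit_mul {u a : T} (hu : IsUnit u) (ha : u * a ∈ balSet T) :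
    a ∈ balSet T := by
  obtain ⟨u, rfl⟩ := hu
  simpa [← mul_assoc] using mul_mem_balSet ((u⁻¹ : Tˣ) : T) ha

/-- If `T ≠ T°`, no invertible element is balanced. -/
theorem not_isUnit_of_mem_balSet (hT : balSet T ≠ Set.univ) {a : T} (ha : a ∈ balSet T) :
    ¬ IsUnit a := by
  intro hu
  refine hT (Set.eq_univ_of_forall fun t => ?_)
  refine mem_balSet_of_unit_mul hu ?_
  rw [mul_comm]
  exact mul_mem_balSet t ha

theorem zero_mem_balSet : (0 : T) ∈ balSet T := ⟨0, by simp [bal_eq]⟩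

theorem not_isUnit_zero_of_balSet_ne_univ (hT : balSet T ≠ Set.univ) : ¬ IsUnit (0 : T) :=
  not_isUnit_of_mem_balSet hT zero_mem_balSet

theorem IsRoot.of_surpasses {p q : T[X]} {r : T} (h : Surpasses (C (Symmetry.sym 1)) p q)
    (hr : IsRoot q r) : IsRoot p r := by
  refine ⟨hr.1, ?_⟩
  obtain ⟨s, rfl⟩ := h
  have : (q + (s + C (Symmetry.sym 1) * s)).eval r = q.eval r + bal (s.eval r) := by
    simp [bal_eq]
  rw [this]
  exact add_mem_balSet hr.2 (bal_mem_balSet _)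

theorem natLE_eval_of_surpasses {p q : T[X]} (h : Surpasses (C (Symmetry.sym 1)) p q) (r : T) :
    NatLE (q.eval r) (p.eval r) := by
  obtain ⟨s, rfl⟩ := h
  exact ⟨_, eval_add⟩

end roots

section semifield

variable {M : Type*} [CommSemiring M]

theorem IsTotalIdemSemifield.add_eq_right (hM : IsTotalIdemSemifield M) {x y : M}
    (h : NatLE x y) : x + y = y := by
  obtain ⟨c, rfl⟩ := h
  rw [← add_assoc, hM.add_idem]

theorem IsTotalIdemSemifield.eq_one_of_mul_self (hM : IsTotalIdemSemifield M) {x : M}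
    (hx : x * x = 1) : x = 1 := by
  have h1 : x * (x + 1) = x + 1 := by rw [mul_add, hx, mul_one, add_comm]
  rcases hM.total x 1 with h | h
  · rw [hM.add_eq_right h, mul_one] at h1
    exact h1
  · rw [add_comm, hM.add_eq_right h, hx] at h1
    exact h1.symm

end semifield

section extended

variable {T M : Type*} [CommSemiring T] [Symmetry T] [CommSemiring M] {μ : T →+* M}

theorem IsExtendedTropical.modulus_bal (hμ : IsExtendedTropical μ) (a : T) : μ (bal a) = μ a := by
  have h1 : μ (Symmetry.sym 1) = 1 := hμ.semifield.eq_one_of_mul_self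
    (by rw [← map_mul, sym_one_mul_self, map_one])
  rw [bal_eq, map_add, map_mul, h1, one_mul, hμ.semifield.add_idem]

/-- An invertible element surpasses only itself. -/
theorem IsExtendedTropical.eq_of_surpasses (hμ : IsExtendedTropical μ)
    (hT : balSet T ≠ Set.univ) {a b : T} (h : Surpasses (Symmetry.sym 1) b a) (hb : IsUnit b) :
    a = b := by
  obtain ⟨c, rfl⟩ := h
  rw [← bal_eq] at hb ⊢
  by_cases hle : NatLE (μ c) (μ a)
  · refine hμ.eq_of_natLE _ _ ⟨bal c, rfl⟩ ?_ (Or.inl hb)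
    rw [map_add, hμ.modulus_bal, add_comm, hμ.semifield.add_eq_right hle]
  · -- otherwise the balanced part dominates and would be invertible
    have hlt : NatLE (μ a) (μ (bal c)) := by
      rw [hμ.modulus_bal]
      exact (hμ.semifield.total _ _).resolve_right hle
    have hne : μ a ≠ μ (bal c) := by
      rw [hμ.modulus_bal]
      intro heq
      exact hle (heq ▸ ⟨0, (add_zero _).symm⟩)
    rw [hμ.add_eq_of_lt _ _ hlt hne] at hb
    exact absurd hb (not_isUnit_of_mem_balSet hT (bal_mem_balSet c))

/-- The invertible coefficients of `p` that exhibit `r` as a corner root are also coefficients of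
`q`, so that `p(r) ≼ q(r) ≼ p(r)`. -/
theorem IsExtendedTropical.isCornerRoot_of_surpasses (hμ : IsExtendedTropical μ)
    (hT : balSet T ≠ Set.univ) {p q : T[X]} {r : T}
    (h : Surpasses (C (Symmetry.sym 1)) p q) (hr : IsCornerRoot μ p r) : IsCornerRoot μ q r := by
  have hqp : NatLE (q.eval r) (p.eval r) := natLE_eval_of_surpasses h r
  suffices heval : q.eval r = p.eval r by
    refine ⟨⟨hr.1.1, heval ▸ hr.1.2⟩, ?_⟩
    rcases hr.2 with ⟨hu, K, hK, hcard, hsum⟩ | ⟨h0, h0'⟩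
    · have hcoeff : ∀ k ∈ K, q.coeff k = p.coeff k := fun k hk =>
        hμ.eq_of_surpasses hT (h.polynomial_coeff k) (hK k hk).2.2
      refine Or.inl ⟨hu, K, fun k hk => ?_, hcard, ?_⟩
      · rw [hcoeff k hk, heval]
        refine ⟨le_natDegree_of_ne_zero fun h0 => ?_, (hK k hk).2⟩
        rw [hcoeff k hk] at h0
        exact not_isUnit_zero_of_balSet_ne_univ hT (h0 ▸ (hK k hk).2.2)
      · rw [heval, hsum]
        exact Finset.sum_congr rfl fun k hk => by rw [hcoeff k hk]
    · exact Or.inr ⟨h0, heval.trans h0'⟩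
  rcases hr.2 with ⟨hu, K, hK, hcard, hsum⟩ | ⟨h0, h0'⟩
  · have hcoeff : ∀ k ∈ K, q.coeff k = p.coeff k := fun k hk =>
      hμ.eq_of_surpasses hT (h.polynomial_coeff k) (hK k hk).2.2
    refine hμ.natLE_antisymm _ _ hqp ?_
    have hsum' : ∑ k ∈ K, p.coeff k * r ^ k = ∑ k ∈ K, q.coeff k * r ^ k :=
      Finset.sum_congr rfl fun k hk => by rw [hcoeff k hk]
    rw [hsum, hsum']
    refine natLE_sum_eval q r K fun k hk => le_natDegree_of_ne_zero fun h0 => ?_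
    rw [hcoeff k hk] at h0
    exact not_isUnit_zero_of_balSet_ne_univ hT (h0 ▸ (hK k hk).2.2)
  · rw [h0'] at hqp ⊢
    exact hμ.natLE_antisymm _ _ hqp ⟨q.eval r, (zero_add _).symm⟩

theorem isRoot_of_C_mul {c : T} (hc : IsUnit c) {p : T[X]} {r : T} (h : IsRoot (C c * p) r) :
    IsRoot p r := by
  refine ⟨h.1, mem_balSet_of_unit_mul hc ?_⟩
  simpa using h.2

theorem isCornerRoot_C_mul {c : T} (hc : IsUnit c) {p : T[X]} {r : T} (h : IsCornerRoot μ p r) :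
    IsCornerRoot μ (C c * p) r := by
  have hdeg : (C c * p).natDegree = p.natDegree := by
    obtain ⟨u, rfl⟩ := hc
    refine le_antisymm (natDegree_C_mul_le _ _) ?_
    calc p.natDegree = (C ((u⁻¹ : Tˣ) : T) * (C (u : T) * p)).natDegree := by
          rw [← mul_assoc, ← C_mul, Units.inv_mul, C_1, one_mul]
      _ ≤ _ := natDegree_C_mul_le _ _
  refine ⟨⟨h.1.1, ?_⟩, ?_⟩
  · rw [eval_C_mul]
    exact mul_mem_balSet c h.1.2
  · rcases h.2 with ⟨hu, K, hK, hcard, hsum⟩ | ⟨h0, h0'⟩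
    · refine Or.inl ⟨hu, K, fun k hk => ⟨hdeg ▸ (hK k hk).1, ?_, ?_⟩, hcard, ?_⟩
      · rw [coeff_C_mul, eval_C_mul, mul_assoc, map_mul, (hK k hk).2.1, ← map_mul]
      · rw [coeff_C_mul]
        exact hc.mul (hK k hk).2.2
      · simp only [eval_C_mul, coeff_C_mul, hsum, Finset.mul_sum, mul_assoc]
    · exact Or.inr ⟨h0, by rw [eval_C_mul, h0', mul_zero]⟩

theorem isUnit_sym_one_pow (n : ℕ) : IsUnit (Symmetry.sym (1 : T) ^ n) := isUnit_sym_one.pow n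

theorem isUnit_of_isRoot_charpoly (hT : balSet T ≠ Set.univ) {n : ℕ}
    {A : Matrix (Fin n) (Fin n) T} (hA : Nonsingular A) {r : T} (hr : IsRoot (charpoly A) r) :
    IsUnit r := by
  refine hr.1.resolve_right ?_
  rintro rfl
  refine not_isUnit_of_mem_balSet hT hr.2 ?_
  rw [eval_charpoly, zero_smul, zero_add, signedDet_smul, Fintype.card_fin]
  exact (isUnit_sym_one_pow n).mul hA

theorem isRoot_revCharpoly {n : ℕ} {A : Matrix (Fin n) (Fin n) T} {u : Tˣ}
    (hr : IsRoot (charpoly A) ((u⁻¹ : Tˣ) : T)) : IsRoot (revCharpoly A) (u : T) := by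
  refine ⟨Or.inl u.isUnit, ?_⟩
  have h := hr.2
  rw [eval_charpoly_inv] at h
  exact mem_balSet_of_unit_mul ((isUnit_sym_one.mul (Units.isUnit _)).pow n) h

theorem isUnit_of_isCornerRoot_revCharpoly (hT : balSet T ≠ Set.univ) {n : ℕ}
    {A : Matrix (Fin n) (Fin n) T} {r : T} (hr : IsCornerRoot μ (revCharpoly A) r) :
    IsUnit r := by
  refine hr.1.1.resolve_right ?_
  rintro rfl
  refine not_isUnit_of_mem_balSet hT hr.1.2 ?_
  rw [eval_revCharpoly, zero_smul, add_zero, signedDet_smul, signedDet_one, mul_one]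
  exact isUnit_sym_one_pow _

/-- Inversion maps the invertible corner roots of the reversed characteristic polynomial to
corner roots of the characteristic polynomial. -/
theorem isCornerRoot_charpoly_inv (hT : balSet T ≠ Set.univ) {n : ℕ}
    {A : Matrix (Fin n) (Fin n) T} {u : Tˣ} (hr : IsCornerRoot μ (revCharpoly A) (u : T)) :
    IsCornerRoot μ (charpoly A) ((u⁻¹ : Tˣ) : T) := by
  have h0 := not_isUnit_zero_of_balSet_ne_univ hT
  have heval := eval_charpoly_inv A u
  refine ⟨⟨Or.inl (Units.isUnit _), heval ▸ mul_mem_balSet _ hr.1.2⟩, Or.inl ⟨Units.isUnit _, ?_⟩⟩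
  rcases hr.2 with ⟨-, K, hK, hcard, hsum⟩ | ⟨hu, -⟩
  · have hKn : ∀ k ∈ K, k ≤ n := fun k hk => by
      by_contra hkn
      have hu := (hK k hk).2.2
      rw [coeff_revCharpoly, if_neg hkn] at hu
      exact h0 hu
    have hterm : ∀ k ∈ K, (charpoly A).coeff (n - k) * ((u⁻¹ : Tˣ) : T) ^ (n - k) =
        (Symmetry.sym 1 * ((u⁻¹ : Tˣ) : T)) ^ n *
          ((revCharpoly A).coeff k * (u : T) ^ k) := fun k hk => by
      obtain ⟨j, hj⟩ := Nat.exists_eq_add_of_le (hKn k hk)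
      rw [coeff_charpoly_sub A (hKn k hk), mul_pow]
      have hu : ((u⁻¹ : Tˣ) : T) ^ (n - k) = ((u⁻¹ : Tˣ) : T) ^ n * (u : T) ^ k := by
        rw [hj, Nat.add_sub_cancel_left, pow_add, mul_right_comm, ← mul_pow, Units.inv_mul,
          one_pow, one_mul]
      rw [hu]
      ring
    have hinj : Set.InjOn (fun k => n - k) (K : Set ℕ) := fun a ha b hb hab => by
      have h1 := hKn a ha
      have h2 := hKn b hb
      dsimp only at hab
      omega
    refine ⟨K.image fun k => n - k, ?_, ?_, ?_⟩
    · intro j hj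
      obtain ⟨k, hk, rfl⟩ := Finset.mem_image.1 hj
      have hunit : IsUnit ((charpoly A).coeff (n - k)) := by
        rw [coeff_charpoly_sub A (hKn k hk)]
        exact (isUnit_sym_one_pow n).mul (hK k hk).2.2
      refine ⟨le_natDegree_of_ne_zero fun h => h0 (h ▸ hunit), ?_, hunit⟩
      rw [hterm k hk, heval, map_mul, (hK k hk).2.1, ← map_mul]
    · rwa [Finset.card_image_of_injOn hinj]
    · rw [Finset.sum_image hinj, heval, hsum, Finset.mul_sum]
      exact Finset.sum_congr rfl fun k hk => (hterm k hk).symm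
  · exact absurd (hu ▸ u.isUnit) h0

end extended

/-! ### The supertropical semiring -/

theorem RMax.eq_zero_or_ofReal (x : RMax) : x = 0 ∨ ∃ a, x = RMax.ofReal a := by
  induction x using Tropical.tropRec with
  | h y =>
    induction y using WithTop.recTopCoe with
    | top => exact Or.inl rfl
    | coe a => exact Or.inr ⟨OrderDual.ofDual a, rfl⟩

theorem RMax.ofReal_injective : Function.Injective RMax.ofReal := by
  intro a b h
  have := Tropical.injective_trop h
  exact OrderDual.toDual.injective (WithTop.coe_injective this)

theorem RMax.ofReal_ne_zero (a : ℝ) : RMax.ofReal a ≠ 0 := by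
  intro h
  exact WithTop.coe_ne_top (Tropical.injective_trop h)

theorem RMax.natLE_ofReal {a b : ℝ} : NatLE (RMax.ofReal a) (RMax.ofReal b) ↔ a ≤ b := by
  constructor
  · rintro ⟨c, hc⟩
    rcases RMax.eq_zero_or_ofReal c with rfl | ⟨c, rfl⟩
    · rw [add_zero] at hc
      exact (RMax.ofReal_injective hc).ge
    · rw [RMax.ofReal_add] at hc
      rw [RMax.ofReal_injective hc]
      exact le_max_left _ _
  · intro h
    exact ⟨RMax.ofReal b, by rw [RMax.ofReal_add, max_eq_right h]⟩

theorem RMax.isTotalIdemSemifield : IsTotalIdemSemifield RMax where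
  isField :=
    { exists_pair_ne := ⟨RMax.ofReal 0, 0, RMax.ofReal_ne_zero 0⟩
      mul_comm := mul_comm
      mul_inv_cancel := by
        intro x hx
        obtain ⟨a, rfl⟩ := (RMax.eq_zero_or_ofReal x).resolve_left hx
        exact ⟨RMax.ofReal (-a), by rw [RMax.ofReal_mul, add_neg_cancel]; rfl⟩ }
  add_idem x := by
    rcases RMax.eq_zero_or_ofReal x with rfl | ⟨a, rfl⟩
    · exact add_zero _
    · rw [RMax.ofReal_add, max_self]
  total x y := by
    rcases RMax.eq_zero_or_ofReal x with rfl | ⟨a, rfl⟩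
    · exact Or.inl ⟨y, (zero_add y).symm⟩
    · rcases RMax.eq_zero_or_ofReal y with rfl | ⟨b, rfl⟩
      · exact Or.inr ⟨_, (zero_add _).symm⟩
      · rw [RMax.natLE_ofReal, RMax.natLE_ofReal]
        exact le_total a b

namespace Supertropical

theorem sym_one : Symmetry.sym (1 : Supertropical) = 1 := rfl

theorem bal_eq_add_self (a : Supertropical) : bal a = a + a := rfl

theorem modulus_bot : modulus bot = 0 := rfl

theorem modulus_tan (a : ℝ) : modulus (tan a) = RMax.ofReal a := rfl

theorem modulus_gho (a : ℝ) : modulus (gho a) = RMax.ofReal a := rfl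

theorem not_isUnit_gho (a : ℝ) : ¬ IsUnit (gho a) := by
  intro h
  obtain ⟨b, hb⟩ := h.exists_right_inv
  cases b <;> simp [mul_bot, gho_mul_tan, gho_mul_gho, one_def] at hb

theorem gho_notMem_thinSet (a : ℝ) : gho a ∉ thinSet Supertropical := by
  rintro (h | h)
  · exact not_isUnit_gho a h
  · rw [zero_def] at h
    cases h

theorem balSet_ne_univ : balSet Supertropical ≠ Set.univ := by
  intro h
  obtain ⟨a, ha⟩ : tan 0 ∈ balSet Supertropical := h ▸ Set.mem_univ _
  rw [bal_eq_add_self] at ha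
  cases a <;> simp [bot_add, tan_add_tan, gho_add_gho] at ha

theorem isExtendedTropical : IsExtendedTropical modulus where
  semifield := RMax.isTotalIdemSemifield
  modulus_surjective x := by
    rcases RMax.eq_zero_or_ofReal x with rfl | ⟨a, rfl⟩
    · exact ⟨bot, rfl⟩
    · exact ⟨tan a, rfl⟩
  natLE_antisymm := by
    rintro a b ⟨c, hc⟩ ⟨d, hd⟩
    cases a <;> cases b <;> cases c <;> cases d <;>
      simp only [bot_add, add_bot, tan_add_tan, tan_add_gho, gho_add_tan,
        gho_add_gho] at hc hd ⊢ <;>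
      grind
  add_eq_of_lt a b h hne := by
    have h0 {x : ℝ} (h : NatLE (RMax.ofReal x) 0) : False := by
      obtain ⟨c, hc⟩ := h
      rcases RMax.eq_zero_or_ofReal c with rfl | ⟨c, rfl⟩
      · rw [add_zero] at hc
        exact RMax.ofReal_ne_zero _ hc.symm
      · rw [RMax.ofReal_add] at hc
        exact RMax.ofReal_ne_zero _ hc.symm
    cases a with
    | bot => exact bot_add b
    | tan x =>
      cases b with
      | bot => exact (h0 h).elim
      | tan y =>
        rw [modulus_tan, modulus_tan] at h hne
        have := (RMax.natLE_ofReal.1 h).lt_of_ne fun hxy => hne (by rw [hxy])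
        rw [tan_add_tan, if_neg this.not_gt, if_pos this]
      | gho y =>
        rw [modulus_tan, modulus_gho] at h
        rw [tan_add_gho, if_neg (RMax.natLE_ofReal.1 h).not_gt]
    | gho x =>
      cases b with
      | bot => exact (h0 h).elim
      | tan y =>
        rw [modulus_gho, modulus_tan] at h hne
        have := (RMax.natLE_ofReal.1 h).lt_of_ne fun hxy => hne (by rw [hxy])
        rw [gho_add_tan, if_pos this]
      | gho y =>
        rw [modulus_gho, modulus_gho] at h hne
        have := (RMax.natLE_ofReal.1 h).lt_of_ne fun hxy => hne (by rw [hxy])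
        rw [gho_add_gho, if_pos this]
  eq_of_natLE := by
    rintro a b ⟨c, hc⟩ hab hb
    cases b with
    | bot =>
      cases a with
      | bot => rfl
      | tan x => exact absurd hab (RMax.ofReal_ne_zero x)
      | gho x => exact absurd hab (RMax.ofReal_ne_zero x)
    | gho y => exact absurd hb (gho_notMem_thinSet y)
    | tan y =>
      cases a with
      | bot => exact absurd hab.symm (RMax.ofReal_ne_zero y)
      | tan x => rw [RMax.ofReal_injective hab]
      | gho x =>
        have hxy : x = y := RMax.ofReal_injective hab
        cases c <;> simp only [add_bot, gho_add_tan, gho_add_gho] at hc <;> grind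
  bal_add_bal a := by
    cases a <;> simp [bal_eq_add_self, bot_add, tan_add_tan, gho_add_gho]

section power

theorem bot_pow {m : ℕ} (hm : m ≠ 0) : bot ^ m = bot := zero_pow hm

theorem tan_pow (a : ℝ) (m : ℕ) : tan a ^ m = tan (m * a) := by
  induction m with
  | zero => simp [one_def]
  | succ m ih =>
    rw [pow_succ, ih, tan_mul_tan]
    push_cast
    congr 1
    ring

theorem gho_pow (a : ℝ) {m : ℕ} (hm : m ≠ 0) : gho a ^ m = gho (m * a) := by
  obtain ⟨m, rfl⟩ := Nat.exists_eq_succ_of_ne_zero hm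
  induction m with
  | zero => simp
  | succ m ih =>
    rw [pow_succ, ih (Nat.succ_ne_zero m), gho_mul_gho]
    push_cast
    congr 1
    ring

theorem add_pow (a b : Supertropical) {m : ℕ} (hm : m ≠ 0) : (a + b) ^ m = a ^ m + b ^ m := by
  have hpos : (0 : ℝ) < m := by exact_mod_cast Nat.pos_of_ne_zero hm
  have hlt (x y : ℝ) : m * x < m * y ↔ x < y := mul_lt_mul_iff_right₀ hpos
  cases a <;> cases b <;>
    simp only [bot_add, add_bot, tan_add_tan, tan_add_gho, gho_add_tan, gho_add_gho, bot_pow hm,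
      tan_pow, gho_pow _ hm, hlt] <;>
    split_ifs <;> simp only [tan_pow, gho_pow _ hm]

/-- The Frobenius property of the supertropical semiring: `x ↦ x ^ m` is an automorphism. -/
noncomputable def powEquiv (m : ℕ) (hm : m ≠ 0) : Supertropical ≃+* Supertropical where
  toFun x := x ^ m
  invFun x := match x with
    | bot => bot
    | tan a => tan (a / m)
    | gho a => gho (a / m)
  left_inv x := by
    have h : (m : ℝ) ≠ 0 := Nat.cast_ne_zero.2 hm
    cases x <;> simp [bot_pow hm, tan_pow, gho_pow _ hm, h]
  right_inv x := by
    have h : (m : ℝ) ≠ 0 := Nat.cast_ne_zero.2 hm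
    cases x <;> simp [bot_pow hm, tan_pow, gho_pow _ hm, h, mul_div_cancel₀]
  map_mul' x y := mul_pow x y m
  map_add' x y := add_pow x y hm

theorem powEquiv_apply {m : ℕ} (hm : m ≠ 0) (x : Supertropical) : powEquiv m hm x = x ^ m := rfl

theorem modulus_powEquiv_symm {m : ℕ} (hm : m ≠ 0) {x y : Supertropical}
    (h : modulus x = modulus y) :
    modulus ((powEquiv m hm).symm x) = modulus ((powEquiv m hm).symm y) := by
  have hbot : (powEquiv m hm).symm bot = bot := rfl
  have htan (a : ℝ) : (powEquiv m hm).symm (tan a) = tan (a / m) := rfl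
  have hgho (a : ℝ) : (powEquiv m hm).symm (gho a) = gho (a / m) := rfl
  have h0 := RMax.ofReal_ne_zero
  cases x <;> cases y <;>
    simp only [hbot, htan, hgho, modulus_bot, modulus_tan, modulus_gho] at h ⊢
  · exact absurd h.symm (h0 _)
  · exact absurd h.symm (h0 _)
  · exact absurd h (h0 _)
  · rw [RMax.ofReal_injective h]
  · rw [RMax.ofReal_injective h]
  · exact absurd h (h0 _)
  · rw [RMax.ofReal_injective h]
  · rw [RMax.ofReal_injective h]

theorem natCast_of_two_le {c : ℕ} (hc : 2 ≤ c) : (c : Supertropical) = 1 + 1 := by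
  induction c, hc using Nat.le_induction with
  | base => norm_num
  | succ c _ ih =>
    rw [Nat.cast_succ, ih]
    simp [one_def, tan_add_tan, gho_add_tan]

end power

end Supertropical

section equiv

variable {T M : Type*} [CommSemiring T] [Symmetry T] [CommSemiring M] {μ : T →+* M}

theorem map_mem_thinSet {S S' : Type*} [CommSemiring S] [CommSemiring S'] (f : S →+* S') {a : S}
    (h : a ∈ thinSet S) : f a ∈ thinSet S' := by
  rcases h with h | rfl
  · exact Or.inl (h.map f)
  · exact Or.inr (map_zero f)

theorem map_mem_balSet (f : T →+* T) (hf : f (Symmetry.sym 1) = Symmetry.sym 1) {a : T}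
    (h : a ∈ balSet T) : f a ∈ balSet T := by
  obtain ⟨b, rfl⟩ := h
  exact ⟨f b, by rw [bal_eq, bal_eq, map_add, map_mul, hf]⟩

theorem IsRoot.map (f : T →+* T) (hf : f (Symmetry.sym 1) = Symmetry.sym 1) {p : T[X]} {r : T}
    (h : IsRoot p r) : IsRoot (p.map f) (f r) := by
  refine ⟨map_mem_thinSet f h.1, ?_⟩
  rw [eval_map_apply]
  exact map_mem_balSet f hf h.2

theorem charpoly_map (f : T →+* T) (hf : f (Symmetry.sym 1) = Symmetry.sym 1) {n : ℕ}
    (A : Matrix (Fin n) (Fin n) T) : charpoly (A.map f) = (charpoly A).map f := by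
  have hA : (A.map C).map (mapRingHom f) = (A.map f).map C := by ext1 i j; simp
  rw [charpoly_eq_signedDet, charpoly_eq_signedDet, ← coe_mapRingHom, map_signedDet,
    FreeSym.map_smul_one_add_smul, hA]
  simp [hf]

theorem IsCornerRoot.map (f : T ≃+* T) (hf : f (Symmetry.sym 1) = Symmetry.sym 1)
    (hμ : ∀ x y, μ x = μ y → μ (f x) = μ (f y)) {p : T[X]} {r : T} (h : IsCornerRoot μ p r) :
    IsCornerRoot μ (p.map (f : T →+* T)) (f r) := by
  have hterm (k : ℕ) : (p.map (f : T →+* T)).coeff k * f r ^ k = f (p.coeff k * r ^ k) := by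
    rw [coeff_map, map_mul, map_pow]
    rfl
  have heval : (p.map (f : T →+* T)).eval (f r) = f (p.eval r) := eval_map_apply (f : T →+* T) r
  refine ⟨h.1.map (f : T →+* T) hf, ?_⟩
  rcases h.2 with ⟨hu, K, hK, hcard, hsum⟩ | ⟨h0, h0'⟩
  · refine Or.inl ⟨hu.map f, K, fun k hk => ⟨?_, ?_, ?_⟩, hcard, ?_⟩
    · rw [natDegree_map_eq_of_injective f.injective]
      exact (hK k hk).1
    · rw [hterm, heval]
      exact hμ _ _ (hK k hk).2.1
    · rw [coeff_map]
      exact (hK k hk).2.2.map _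
    · simp only [hterm, heval, hsum, map_sum]
  · exact Or.inr ⟨by rw [h0, map_zero], by rw [heval, h0', map_zero]⟩

end equiv

/-! ### Powers of supertropical matrices -/

theorem Surpasses.of_polynomial_coeff {S : Type*} [CommSemiring S] {e : S} {p q : S[X]}
    (h : ∀ k, Surpasses e (p.coeff k) (q.coeff k)) : Surpasses (C e) p q := by
  classical
  choose r hr using h
  refine ⟨∑ k ∈ p.support ∪ q.support, monomial k (r k), ?_⟩
  ext k
  have hk : (∑ k ∈ p.support ∪ q.support, monomial k (r k)).coeff k =
      if k ∈ p.support ∪ q.support then r k else 0 := by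
    simp only [finsetSum_coeff, coeff_monomial]
    exact Finset.sum_ite_eq' _ _ _
  rw [coeff_add, coeff_add, coeff_C_mul, hk]
  split_ifs with h
  · exact hr k
  · rw [Finset.mem_union, not_or, notMem_support_iff, notMem_support_iff] at h
    simp [h.1, h.2]

section frobenius

variable {R : Type*} [CommRing R] {p : ℕ} [Fact p.Prime] [CharP R p] {n : ℕ}

theorem det_pow_char_smul_one_add (B : Matrix (Fin n) (Fin n) R) (y : R) :
    (y ^ p • (1 : Matrix (Fin n) (Fin n) R) + B ^ p).det =
      (y • (1 : Matrix (Fin n) (Fin n) R) + B).det ^ p := by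
  rcases Nat.eq_zero_or_pos n with rfl | hn
  · simp
  · have : Nonempty (Fin n) := ⟨⟨0, hn⟩⟩
    rw [← Matrix.det_pow, add_pow_char_of_commute p, _root_.smul_pow, one_pow]
    exact (Commute.one_left B).smul_left y

end frobenius

namespace FreeSym

variable {n : ℕ}

theorem IsSimple.expand {σ : Type*} {q : FreeSym σ} (hq : q.IsSimple) {p : ℕ} (hp : p ≠ 0) :
    IsSimple (MvPolynomial.expand p q) := by
  classical
  intro m
  by_cases hm : m ∈ (MvPolynomial.expand p q).support
  · obtain ⟨a, -, rfl⟩ := Finset.mem_image.1 (MvPolynomial.support_expand_subset q hm)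
    rw [MvPolynomial.coeff_expand_smul _ hp]
    exact hq a
  · exact Or.inl (MvPolynomial.notMem_support_iff.1 hm)

/-- The expression `det(E)^p det(Y^p I ⊕ (W A)^p)` for generic `E`, `A`, `Y` and `W`. -/
noncomputable def genericPowChar (n p : ℕ) : FreeSym (CharVar n) :=
  signedDet (omega _) (leftMatrix n) ^ p * signedDet (omega _)
    ((MvPolynomial.X .shift : FreeSym (CharVar n)) ^ p • (1 : Matrix (Fin n) (Fin n) _) +
      (1 : FreeSym (CharVar n)) •
        ((MvPolynomial.X .scale : FreeSym (CharVar n)) • rightMatrix n) ^ p)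

theorem map_matrix_smul_pow {S S' : Type*} [CommSemiring S] [CommSemiring S'] (f : S →+* S')
    (w : S) (A : Matrix (Fin n) (Fin n) S) (p : ℕ) :
    ((w • A) ^ p).map f = (f w • A.map f) ^ p := by
  have h : (w • A).map f = f w • A.map f := by ext1 i j; simp
  rw [Matrix.map_pow, h]

theorem map_genericPowChar {S : Type*} [CommSemiring S] (f : FreeSym (CharVar n) →+* S) (p : ℕ) :
    f (genericPowChar n p) = signedDet (f (omega _)) ((leftMatrix n).map f) ^ p *
      signedDet (f (omega _)) (f (MvPolynomial.X .shift) ^ p • (1 : Matrix (Fin n) (Fin n) S) +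
        (f (MvPolynomial.X .scale) • (rightMatrix n).map f) ^ p) := by
  rw [genericPowChar, map_mul, map_pow, map_signedDet, map_signedDet, map_smul_one_add_smul,
    map_matrix_smul_pow, map_one, one_smul, map_pow]

/-- In characteristic `p`, the matrices `Y^p I + (W A)^p` and `(Y I + W A)^p` are equal, and the
`p`-th power of an integral polynomial is the polynomial in the `p`-th powers of the variables. -/
theorem map_zmod_genericPowChar (p : ℕ) [Fact p.Prime] :
    MvPolynomial.map (SignNat.lift (-1 : ZMod p) (by norm_num)) (genericPowChar n p) =
      MvPolynomial.map (SignNat.lift (-1 : ZMod p) (by norm_num))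
        (MvPolynomial.expand p (genericChar n)) := by
  have hω : MvPolynomial.map (SignNat.lift (-1 : ZMod p) (by norm_num)) (omega (CharVar n)) =
      -1 := by
    rw [omega, MvPolynomial.map_C, SignNat.lift_omega, MvPolynomial.C_neg, MvPolynomial.C_1]
  rw [map_genericPowChar, MvPolynomial.map_expand, MvPolynomial.expand_zmod, genericChar, map_mul,
    map_signedDet, map_signedDet, map_smul_one_add_smul, mul_pow, hω, signedDet_neg_one,
    signedDet_neg_one, signedDet_neg_one, det_pow_char_smul_one_add]

end FreeSym

namespace Supertropical

/-- The coefficientwise comparison behind the transfer to the supertropical semiring, where all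
natural numbers from `2` on have the same ghost image. -/
theorem surpasses_lift {p : ℕ} (hp : p.Prime) {x y : SignNat}
    (hxy : SignNat.lift (-1 : ZMod p) (by norm_num) x =
      SignNat.lift (-1 : ZMod p) (by norm_num) y)
    (hy : y = 0 ∨ y = 1 ∨ y = SignNat.omega) :
    Surpasses (1 : Supertropical) (SignNat.lift 1 (one_mul 1) x)
      (SignNat.lift 1 (one_mul 1) y) := by
  have : Fact p.Prime := ⟨hp⟩
  have hone : (1 : ZMod p) ≠ 0 := one_ne_zero
  have hx : SignNat.lift (1 : Supertropical) (one_mul 1) x =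
      ((x.re + x.im : ℕ) : Supertropical) := by
    rw [SignNat.lift_apply, mul_one, Nat.cast_add]
  have h3 : (1 : Supertropical) + (1 + 1) = 1 + 1 := by
    simp [one_def, tan_add_tan, tan_add_gho]
  have hlift (c : SignNat) : SignNat.lift (-1 : ZMod p) (by norm_num) c = c.re - c.im := by
    rw [SignNat.lift_apply, mul_neg_one, sub_eq_add_neg]
  have hzero : x.re + x.im = 0 → SignNat.lift (-1 : ZMod p) (by norm_num) x = 0 := by
    intro h
    have h1 : x.re = 0 := by omega
    have h2 : x.im = 0 := by omega
    rw [hlift, h1, h2]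
    simp
  have hunit : x.re + x.im = 1 → SignNat.lift (-1 : ZMod p) (by norm_num) x ≠ 0 := by
    intro h
    have h1 : (x.re = 1 ∧ x.im = 0) ∨ (x.re = 0 ∧ x.im = 1) := by omega
    rcases h1 with ⟨h1, h2⟩ | ⟨h1, h2⟩ <;> rw [hlift, h1, h2] <;> simp
  have hpos : SignNat.lift (-1 : ZMod p) (by norm_num) y ≠ 0 →
      SignNat.lift (1 : Supertropical) (one_mul 1) y = 1 →
      Surpasses (1 : Supertropical) (SignNat.lift 1 (one_mul 1) x)
        (SignNat.lift 1 (one_mul 1) y) := by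
    intro h0 h1
    rw [← hxy] at h0
    rw [h1, hx]
    rcases Nat.lt_or_ge (x.re + x.im) 2 with h | h
    · have : x.re + x.im = 1 := by
        have := mt hzero h0
        omega
      rw [this, Nat.cast_one]
      exact Surpasses.refl _ _
    · exact ⟨1, by rw [natCast_of_two_le h, one_mul, h3]⟩
  rcases hy with rfl | rfl | rfl
  · rw [map_zero] at hxy ⊢
    rw [hx]
    rcases Nat.lt_or_ge (x.re + x.im) 2 with h | h
    · have : x.re + x.im = 0 := by
        have := mt hunit (not_not.2 hxy)
        omega
      rw [this, Nat.cast_zero]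
      exact Surpasses.refl _ _
    · exact ⟨1, by rw [natCast_of_two_le h, one_mul, zero_add]⟩
  · exact hpos (by rw [map_one]; exact hone) (map_one _)
  · exact hpos (by rw [SignNat.lift_omega]; exact neg_ne_zero.2 hone) (SignNat.lift_omega _ _)

theorem surpasses_eval_of_map_zmod_eq {σ : Type*} {p : ℕ} (hp : p.Prime) {P Q : FreeSym σ}
    (h : MvPolynomial.map (SignNat.lift (-1 : ZMod p) (by norm_num)) P =
      MvPolynomial.map (SignNat.lift (-1 : ZMod p) (by norm_num)) Q)
    (hQ : Q.IsSimple) (v : σ → Supertropical[X]) :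
    Surpasses 1 (FreeSym.eval 1 (one_mul 1) v P) (FreeSym.eval 1 (one_mul 1) v Q) := by
  have hcomp (F : FreeSym σ) : FreeSym.eval (1 : Supertropical[X]) (one_mul 1) v F =
      MvPolynomial.eval₂Hom C v
        (MvPolynomial.map (SignNat.lift (1 : Supertropical) (one_mul 1)) F) := by
    rw [MvPolynomial.coe_eval₂Hom, MvPolynomial.eval₂_map, FreeSym.eval,
      MvPolynomial.coe_eval₂Hom]
    congr 1
    ext x
    simp [SignNat.lift_apply]
  have key : Surpasses (MvPolynomial.C (1 : Supertropical))
      (MvPolynomial.map (SignNat.lift (1 : Supertropical) (one_mul 1)) P)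
      (MvPolynomial.map (SignNat.lift (1 : Supertropical) (one_mul 1)) Q) := by
    refine Surpasses.of_mvPolynomial_coeff fun m => ?_
    rw [MvPolynomial.coeff_map, MvPolynomial.coeff_map]
    refine surpasses_lift hp ?_ (hQ m)
    rw [← MvPolynomial.coeff_map, ← MvPolynomial.coeff_map, h]
  rw [hcomp, hcomp]
  simpa using key.map (MvPolynomial.eval₂Hom C v)

theorem charpoly_eq {n : ℕ} (A : Matrix (Fin n) (Fin n) Supertropical) :
    charpoly A = signedDet 1
      ((X : Supertropical[X]) • (1 : Matrix (Fin n) (Fin n) Supertropical[X]) + A.map C) := by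
  rw [charpoly_eq_signedDet, sym_one, C_1, one_smul]

theorem expand_charpoly {n : ℕ} (A : Matrix (Fin n) (Fin n) Supertropical) (p : ℕ) :
    expand Supertropical p (charpoly A) = signedDet 1
      ((X : Supertropical[X]) ^ p • (1 : Matrix (Fin n) (Fin n) Supertropical[X]) + A.map C) := by
  have hA : (A.map C).map (expand Supertropical p : Supertropical[X] →+* Supertropical[X]) =
      A.map C := by
    ext1 i j
    simp
  have h := map_signedDet (expand Supertropical p : Supertropical[X] →+* Supertropical[X]) 1
    ((X : Supertropical[X]) • (1 : Matrix (Fin n) (Fin n) Supertropical[X]) +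
      (1 : Supertropical[X]) • A.map C)
  rw [FreeSym.map_smul_one_add_smul, hA, map_one, one_smul, ← charpoly_eq] at h
  simpa using h

/-- Both sides are compared after substituting `X ^ p` for `X`, where the right-hand side becomes
the generic expression evaluated at the `p`-th powers of the entries of `A` and of `X`. -/
theorem surpasses_charpoly_pow_prime {n : ℕ} (A : Matrix (Fin n) (Fin n) Supertropical) {p : ℕ}
    (hp : p.Prime) :
    Surpasses 1 (charpoly (A ^ p)) (charpoly (A.map (powEquiv p hp.ne_zero))) := by
  have : Fact p.Prime := ⟨hp⟩
  have key := surpasses_eval_of_map_zmod_eq hp (FreeSym.map_zmod_genericPowChar (n := n) p)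
    ((FreeSym.isSimple_genericChar n).expand hp.ne_zero) (FreeSym.charVal 1 (A.map C) X 1)
  have hv : FreeSym.charVal (1 : Matrix (Fin n) (Fin n) Supertropical[X]) (A.map C) X 1 ^ p =
      FreeSym.charVal 1 ((A.map (powEquiv p hp.ne_zero)).map C) (X ^ p) 1 := by
    funext s
    rw [Pi.pow_apply]
    cases s with
    | left i j =>
      by_cases hij : i = j <;> simp [FreeSym.charVal, Matrix.one_apply, hij, hp.ne_zero]
    | right i j => simp [FreeSym.charVal, powEquiv_apply]
    | shift => rfl
    | scale => exact one_pow p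
  have hQ : FreeSym.eval 1 (one_mul 1) (FreeSym.charVal 1 (A.map C) X 1)
      (MvPolynomial.expand p (FreeSym.genericChar n)) =
      expand Supertropical p (charpoly (A.map (powEquiv p hp.ne_zero))) := by
    rw [FreeSym.eval, MvPolynomial.coe_eval₂Hom, MvPolynomial.eval₂_expand, hv,
      ← MvPolynomial.coe_eval₂Hom]
    refine (FreeSym.eval_genericChar (one_mul 1) _ _ _ _).trans ?_
    rw [signedDet_one, one_mul, one_smul, expand_charpoly]
  have hP : FreeSym.eval 1 (one_mul 1) (FreeSym.charVal 1 (A.map C) X 1)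
      (FreeSym.genericPowChar n p) = expand Supertropical p (charpoly (A ^ p)) := by
    rw [FreeSym.map_genericPowChar, FreeSym.map_eval_leftMatrix, FreeSym.map_eval_rightMatrix,
      FreeSym.eval_omega, FreeSym.eval_X, FreeSym.eval_X, signedDet_one, one_pow, one_mul,
      expand_charpoly, Matrix.map_pow]
    simp [FreeSym.charVal]
  rw [hP, hQ] at key
  rw [← C_1]
  refine Surpasses.of_polynomial_coeff fun k => ?_
  rw [← C_1] at key
  have hk := key.polynomial_coeff (k * p)
  rwa [coeff_expand_mul hp.pos, coeff_expand_mul hp.pos] at hk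

/-- The characteristic polynomial of `A ^ m` surpasses the polynomial whose coefficients are the
`m`-th powers of those of the characteristic polynomial of `A`. -/
theorem surpasses_charpoly_pow {n : ℕ} (A : Matrix (Fin n) (Fin n) Supertropical) {m : ℕ}
    (hm : m ≠ 0) :
    Surpasses 1 (charpoly (A ^ m))
      ((charpoly A).map (powEquiv m hm : Supertropical →+* Supertropical)) := by
  have hsym {m : ℕ} (hm : m ≠ 0) :
      (powEquiv m hm : Supertropical →+* Supertropical) (Symmetry.sym 1) = Symmetry.sym 1 :=
    map_one (powEquiv m hm : Supertropical →+* Supertropical)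
  induction m using induction_on_primes with
  | zero => exact absurd rfl hm
  | one =>
    have : (powEquiv 1 hm : Supertropical →+* Supertropical) = RingHom.id _ := by
      ext x
      exact pow_one x
    rw [this, map_id, pow_one]
    exact Surpasses.refl _ _
  | prime_mul p a hp ih =>
    have ha : a ≠ 0 := right_ne_zero_of_mul hm
    have h1 := surpasses_charpoly_pow_prime (A ^ a) hp
    have h2 := (ih ha).map
      (mapRingHom (powEquiv p hp.ne_zero : Supertropical →+* Supertropical))
    rw [map_one, coe_mapRingHom, ← charpoly_map _ (hsym _), Polynomial.map_map] at h2
    have hcomp : (powEquiv p hp.ne_zero : Supertropical →+* Supertropical).comp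
        (powEquiv a ha : Supertropical →+* Supertropical) =
        (powEquiv (p * a) hm : Supertropical →+* Supertropical) := by
      ext x
      change (x ^ a) ^ p = x ^ (p * a)
      rw [← pow_mul, mul_comm]
    rw [hcomp] at h2
    have hpow : A ^ (p * a) = (A ^ a) ^ p := by rw [mul_comm, pow_mul]
    rw [hpow]
    exact h1.trans h2

end Supertropical

end ExtTrop

theorem corollary6p5 (n : ℕ) :
    -- the cases `M = E^∇ A E`, `g = id`, and `M = A^∇`, `g(x) = x⁻¹`, over a general `T ≠ T°`
    (∀ (T : Type*) (M : Type*) [CommSemiring T] [ExtTrop.Symmetry T] [CommSemiring M]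
        (μ : T →+* M), ExtTrop.IsExtendedTropical μ → ExtTrop.balSet T ≠ Set.univ →
        ∀ A : Matrix (Fin n) (Fin n) T,
      (∀ E : Matrix (Fin n) (Fin n) T, ExtTrop.Nonsingular E →
        (∀ γ : T, ExtTrop.IsRoot (ExtTrop.charpoly A) γ →
          ExtTrop.IsRoot (ExtTrop.charpoly (ExtTrop.quasiInv E * A * E)) γ) ∧
        (∀ l : T, ExtTrop.IsEigenvalue μ (ExtTrop.quasiInv E * A * E) l →
          ExtTrop.IsEigenvalue μ A l)) ∧
      (ExtTrop.Nonsingular A →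
        (∀ γ : T, ExtTrop.IsRoot (ExtTrop.charpoly A) γ →
          ∃ u : Tˣ, (u : T) = γ ∧
            ExtTrop.IsRoot (ExtTrop.charpoly (ExtTrop.quasiInv A)) ((u⁻¹ : Tˣ) : T)) ∧
        (∀ l : T, ExtTrop.IsEigenvalue μ (ExtTrop.quasiInv A) l →
          ∃ u : Tˣ, (u : T) = l ∧ ExtTrop.IsEigenvalue μ A ((u⁻¹ : Tˣ) : T)))) ∧
    -- the case `M = A^m`, `g(x) = x^m`, over the supertropical semiring
    (∀ (A : Matrix (Fin n) (Fin n) ExtTrop.Supertropical) (m : ℕ), 1 ≤ m →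
      ∃ g : ExtTrop.Supertropical ≃ ExtTrop.Supertropical, (∀ x, g x = x ^ m) ∧
        (∀ γ, ExtTrop.IsRoot (ExtTrop.charpoly A) γ →
          ExtTrop.IsRoot (ExtTrop.charpoly (A ^ m)) (g γ)) ∧
        (∀ l, ExtTrop.IsEigenvalue ExtTrop.Supertropical.modulus (A ^ m) l →
          ExtTrop.IsEigenvalue ExtTrop.Supertropical.modulus A (g.symm l))) := by
  refine ⟨?_, ?_⟩
  · intro T M _ _ _ μ hμ hT A
    refine ⟨fun E hE => ?_, fun hA => ?_⟩
    · have h := ExtTrop.surpasses_charpoly_conj hE A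
      exact ⟨fun γ hγ => hγ.of_surpasses h, fun l hl => hμ.isCornerRoot_of_surpasses hT h hl⟩
    · have h := ExtTrop.surpasses_charpoly_quasiInv hA
      have hC : IsUnit (Polynomial.C (ExtTrop.det A)) := hA.map Polynomial.C
      refine ⟨fun γ hγ => ?_, fun l hl => ?_⟩
      · obtain ⟨u, rfl⟩ := ExtTrop.isUnit_of_isRoot_charpoly hT hA hγ
        refine ⟨u, rfl, ExtTrop.isRoot_of_C_mul hA ?_⟩
        exact (ExtTrop.isRoot_revCharpoly (u := u⁻¹) (by rwa [inv_inv])).of_surpasses h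
      · have hl' := hμ.isCornerRoot_of_surpasses hT h (ExtTrop.isCornerRoot_C_mul hA hl)
        obtain ⟨u, rfl⟩ := ExtTrop.isUnit_of_isCornerRoot_revCharpoly hT hl'
        exact ⟨u, rfl, ExtTrop.isCornerRoot_charpoly_inv hT hl'⟩
  · intro A m hm
    have hm0 : m ≠ 0 := Nat.one_le_iff_ne_zero.1 hm
    let f := ExtTrop.Supertropical.powEquiv m hm0
    have h : ExtTrop.Surpasses (Polynomial.C (ExtTrop.Symmetry.sym (1 : ExtTrop.Supertropical)))
        (ExtTrop.charpoly (A ^ m))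
        ((ExtTrop.charpoly A).map (f : ExtTrop.Supertropical →+* ExtTrop.Supertropical)) := by
      rw [ExtTrop.Supertropical.sym_one, Polynomial.C_1]
      exact ExtTrop.Supertropical.surpasses_charpoly_pow A hm0
    refine ⟨f.toEquiv, fun x => rfl, fun γ hγ => ?_, fun l hl => ?_⟩
    · exact (hγ.map (f : ExtTrop.Supertropical →+* ExtTrop.Supertropical)
        (map_one (f : ExtTrop.Supertropical →+* ExtTrop.Supertropical))).of_surpasses h
    · have hl' := ExtTrop.Supertropical.isExtendedTropical.isCornerRoot_of_surpasses
        ExtTrop.Supertropical.balSet_ne_univ h hl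
      have hmap := hl'.map f.symm (map_one f.symm)
        fun x y => ExtTrop.Supertropical.modulus_powEquiv_symm hm0
      rw [Polynomial.map_map] at hmap
      have hid : (f.symm : ExtTrop.Supertropical →+* ExtTrop.Supertropical).comp
          (f : ExtTrop.Supertropical →+* ExtTrop.Supertropical) = RingHom.id _ := by
        ext x
        exact f.symm_apply_apply x
      rw [hid, Polynomial.map_id] at hmap
      exact hmap
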